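/- \textbf{Dynamic programs.} Fix a relational input schema $\sigma$. A \emph{dynamic program} has a finite relational auxiliary schema $\tau_{\mathrm{aux}}$ and, for every auxiliary relation symbol $T$ of arity $\ell$, one first-order formula $\varphi_T(x_1,\dots,x_\ell)$ over $\sigma\cup\tau_{\mathrm{aux}}$ (its update rule). It is run on an arbitrary finite domain $D$, starting with all input and auxiliary relations empty. When the input structure $\mathcal I$ is changed to $\mathcal I+\Delta\mathcal I$ (every input relation $R$ becomes $(R\cup R^+)\setminus R^-$), all auxiliary relations are updated simultaneously by $T:=\{\bar a\mid(\mathcal I+\Delta\mathcal I,\mathcal A)\models\varphi_T(\bar a)\}$, where $\mathcal A$ is the auxiliary structure before the change. The program does not depend on $D$, and no order on $D$ is given. A finite family of queries \emph{can be maintained in $\mathsf{DynFO}$} under a class of changes if a single dynamic program has, for every query $Q$ of the family, an auxiliary relation that, on every finite domain and after every non-empty sequence of changes of the class, equals the result of $Q$ on the current input structure. \textbf{BC-trees.} A cut vertex of a connected graph is a vertex whose deletion disconnects the graph; a graph is biconnected if it is connected and has no cut vertex; a block is (the vertex set of) a maximal biconnected subgraph. The BC-tree $T_2(H)$ of a connected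 graph $H$ has as nodes the blocks of $H$ (block nodes) and the cut vertices of $H$ (cut nodes); a cut node and a block node are adjacent iff the cut vertex belongs to the block. A node $Y$ is between nodes $X$ and $Z$ if it lies on the path from $X$ to $Z$ in $T_2(H)$ (end points included). Nodes are named by pairs of vertices: a block with at least two vertices is named by each pair $(a,b)$ of distinct vertices of it; a block that consists of one (isolated) vertex $v$, and a cut vertex $v$, are named by $(v,v)$. \textbf{Lemma.} The BC-trees of all connected components of an undirected graph $G$, together with the betweenness relation on their nodes, can be maintained in $\mathsf{DynFO}$ under insertions and deletions of single undirected edges. That is, a single dynamic program maintains all of the following relations, in terms of the names of nodes of the BC-trees of the connected components of $G$: $(a,b)$ names a block node; $(a,b)$ names a cut node; $(a,b)$ and $(c,d)$ name the same node; $(a,b)$ names a node to which the vertex $v$ belongs; $(a,b)$ and $(c,d)$ name adjacent nodes of the BC-tree of a component; $(a,b)$, $(c,d)$, $(e,f)$ name nodes $X,Y,Z$ of the BC-tree of a component such that $Y$ is between $X$ and $Z$. -/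

import Mathlib

/-! ### Dynamic programs with first-order update rules -/

namespace DynFO

/-- The interpretation of all relation symbols of the schema `τ` over the domain `D`. -/
abbrev Interp (τ : FirstOrder.Language.{0, 0}) (D : Type) : Type :=
  (n : ℕ) → τ.Relations n → Set (Fin n → D)

/-- All relations are empty. -/
def Interp.empty (τ : FirstOrder.Language.{0, 0}) (D : Type) : Interp τ D := fun _ _ => ∅

/-- An interpretation of a relational schema, as a first-order structure. -/
@[reducible]
def Interp.toStructure {τ : FirstOrder.Language.{0, 0}} [τ.IsRelational] {D : Type} (A : Interp τ D) :
    τ.Structure D where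
  funMap := fun f _ => isEmptyElim f
  RelMap := fun R x => x ∈ A _ R

/-- `(𝓘, 𝓐) ⊨ φ(x)` for a first-order formula `φ` over the disjoint union of two schemas. -/
def Holds {σ τ : FirstOrder.Language.{0, 0}} [σ.IsRelational] [τ.IsRelational] {D : Type}
    (I : Interp σ D) (A : Interp τ D) {n : ℕ} (φ : (σ.sum τ).Formula (Fin n))
    (x : Fin n → D) : Prop :=
  letI := I.toStructure
  letI := A.toStructure
  φ.Realize x

/-- A change: for every relation symbol a set of tuples to insert and a set of tuples to delete. -/
structure Change (σ : FirstOrder.Language.{0, 0}) (D : Type) where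
  ins : Interp σ D
  del : Interp σ D

/-- The structure `𝓘 + Δ𝓘`. -/
def Change.apply {σ : FirstOrder.Language.{0, 0}} {D : Type} (Δ : Change σ D) (I : Interp σ D) :
    Interp σ D :=
  fun n R => (I n R ∪ Δ.ins n R) \ Δ.del n R

/-- A dynamic program over the input schema `σ`: a finite relational auxiliary schema, and for
each auxiliary relation symbol a first-order update rule over input and auxiliary schema. -/
structure Program (σ : FirstOrder.Language.{0, 0}) where
  aux : FirstOrder.Language.{0, 0}
  relational : aux.IsRelational
  finite : Finite (Σ n, aux.Relations n)
  rule : (n : ℕ) → aux.Relations n → (σ.sum aux).Formula (Fin n)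

/-- A state of a dynamic program: input structure and auxiliary structure. -/
structure State {σ : FirstOrder.Language.{0, 0}} (P : Program σ) (D : Type) where
  input : Interp σ D
  aux : Interp P.aux D

/-- The initial state: input and auxiliary structure are empty. -/
def State.init {σ : FirstOrder.Language.{0, 0}} (P : Program σ) (D : Type) : State P D :=
  ⟨Interp.empty σ D, Interp.empty P.aux D⟩

/-- One step: the change is applied to the input, and simultaneously every auxiliary relation is
replaced by the result of its update rule, evaluated in the new input structure together with the
old auxiliary structure. -/
def State.step {σ : FirstOrder.Language.{0, 0}} [σ.IsRelational] {P : Program σ} {D : Type}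
    (S : State P D) (Δ : Change σ D) : State P D :=
  haveI := P.relational
  ⟨Δ.apply S.input, fun n T => {x | Holds (Δ.apply S.input) S.aux (P.rule n T) x}⟩

/-- The state reached from the initial one by a sequence of changes. -/
def Program.run {σ : FirstOrder.Language.{0, 0}} [σ.IsRelational] (P : Program σ) {D : Type}
    (α : List (Change σ D)) : State P D :=
  α.foldl State.step (State.init P D)

/-- A `q`-ary query on `σ`-structures. -/
abbrev Query (σ : FirstOrder.Language.{0, 0}) (q : ℕ) : Type 1 :=
  (D : Type) → Interp σ D → Set (Fin q → D)

/-- A family of queries can be maintained in DynFO under the changes in `𝒞`: a single dynamic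
program has for every query `Q k` of the family an auxiliary relation `ans k` which, over every
finite domain and after every non-empty sequence of admissible changes applied to the empty
structure, is the result of `Q k` on the current input structure. -/
def Maintainable {σ : FirstOrder.Language.{0, 0}} [σ.IsRelational]
    (𝒞 : (D : Type) → Set (Change σ D)) {κ : Type} {q : κ → ℕ}
    (Q : (k : κ) → Query σ (q k)) : Prop :=
  ∃ (P : Program σ) (ans : (k : κ) → P.aux.Relations (q k)),
    ∀ (D : Type) [Finite D] (α : List (Change σ D)),
      α ≠ [] → (∀ Δ ∈ α, Δ ∈ 𝒞 D) →
        ∀ k : κ, (P.run α).aux (q k) (ans k) = Q k D (P.run α).input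

/-! ### Undirected graphs as input structures, and edge updates -/

/-- The interpretation of the schema of graphs in which the edge relation is `E`. -/
def edgeInterp {D : Type} (E : D → D → Prop) : Interp FirstOrder.Language.graph D
  | _, .adj => {x | E (x 0) (x 1)}

/-- The two tuples that represent the undirected edge `{a, b}`. -/
def edgeTuples {D : Type} (a b : D) : D → D → Prop :=
  fun x y => (x = a ∧ y = b) ∨ (x = b ∧ y = a)

/-- Insertion of the undirected edge `{a, b}`. -/
def insertEdge {D : Type} (a b : D) : Change FirstOrder.Language.graph D :=
  ⟨edgeInterp (edgeTuples a b), Interp.empty _ D⟩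

/-- Deletion of the undirected edge `{a, b}`. -/
def deleteEdge {D : Type} (a b : D) : Change FirstOrder.Language.graph D :=
  ⟨Interp.empty _ D, edgeInterp (edgeTuples a b)⟩

/-- The edge updates of an undirected graph on `D`: insertion or deletion of one edge. -/
def edgeUpdates (D : Type) : Set (Change FirstOrder.Language.graph D) :=
  {Δ | ∃ a b : D, a ≠ b ∧ (Δ = insertEdge a b ∨ Δ = deleteEdge a b)}

/-- The undirected graph that an input structure represents. -/
def toGraph {D : Type} (I : Interp FirstOrder.Language.graph D) : SimpleGraph D :=
  SimpleGraph.fromRel fun x y => ![x, y] ∈ I 2 FirstOrder.Language.adj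

end DynFO

/-! ### Block-cut trees -/

namespace BCTree

/-- `v` is a cut vertex of the connected graph `H`: its deletion disconnects `H`. -/
def IsCutVertex {W : Type} (H : SimpleGraph W) (v : W) : Prop :=
  H.Connected ∧ ¬ (H.induce {v}ᶜ).Preconnected

/-- A graph is biconnected if it is connected and has no cut vertex. (In particular the graphs
with one vertex and with one edge are biconnected.) -/
def Biconnected {W : Type} (H : SimpleGraph W) : Prop :=
  H.Connected ∧ ∀ v, ¬ IsCutVertex H v

/-- `B` is the vertex set of a biconnected component (block): a maximal biconnected subgraph. -/
def IsBlock {W : Type} (H : SimpleGraph W) (B : Set W) : Prop :=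
  Maximal (fun S : Set W => Biconnected (H.induce S)) B

/-- The nodes of the BC-tree: the blocks and the cut vertices. -/
inductive Node {W : Type} (H : SimpleGraph W) : Type
  | block (B : Set W) (hB : IsBlock H B) : Node H
  | cut (v : W) (hv : IsCutVertex H v) : Node H

/-- The vertices of the subgraph that a node stands for. -/
def Node.verts {W : Type} {H : SimpleGraph W} : Node H → Set W
  | .block B _ => B
  | .cut v _ => {v}

def Node.IsBlockNode {W : Type} {H : SimpleGraph W} : Node H → Prop
  | .block _ _ => True
  | .cut _ _ => False

def Node.IsCutNode {W : Type} {H : SimpleGraph W} : Node H → Prop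
  | .block _ _ => False
  | .cut _ _ => True

/-- The BC-tree of a connected graph `H`: a cut node and a block node are adjacent iff the cut
vertex belongs to the block. -/
def tree {W : Type} (H : SimpleGraph W) : SimpleGraph (Node H) :=
  SimpleGraph.fromRel fun X Y =>
    match X, Y with
    | .cut v _, .block B _ => v ∈ B
    | _, _ => False

/-- `Y` lies on the path between `X` and `Z` in the tree (end points included). -/
def Between {W : Type} {H : SimpleGraph W} (X Y Z : Node H) : Prop :=
  ∃ p : (tree H).Walk X Z, p.IsPath ∧ Y ∈ p.support

/-- The BC-tree of the connected component `C` of `G` has the nodes `CNode C`. -/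
abbrev CNode {V : Type} {G : SimpleGraph V} (C : G.ConnectedComponent) : Type :=
  Node C.toSimpleGraph

/-- The vertices of a node, as vertices of the whole graph. -/
def CNode.vertices {V : Type} {G : SimpleGraph V} {C : G.ConnectedComponent} (X : CNode C) :
    Set V :=
  (fun w : C => (w : V)) '' X.verts

/-- The pair `(a, b)` is a name of the node `X`. A block with at least two vertices is named by the
pairs of two distinct vertices in it, a block that consists of an isolated vertex `v` only, and
a cut vertex `v`, by `(v, v)`. -/
def Names {V : Type} {G : SimpleGraph V} {C : G.ConnectedComponent} (a b : V) (X : CNode C) :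
    Prop :=
  a ∈ X.vertices ∧ b ∈ X.vertices ∧ (a = b → X.vertices = {a})

/-- The relations that describe the BC-trees of the connected components of a graph. -/
inductive Rel : Type
  | blockNode
  | cutNode
  | sameNode
  | vertexOf
  | treeEdge
  | between

def Rel.arity : Rel → ℕ
  | .blockNode => 2
  | .cutNode => 2
  | .sameNode => 4
  | .vertexOf => 3
  | .treeEdge => 4
  | .between => 6

/-- The tuples of vertices in each of these relations. Nodes are given by their names. -/
def Rel.eval {V : Type} (G : SimpleGraph V) : (r : Rel) → Set (Fin r.arity → V)
  | .blockNode => {x : Fin 2 → V | ∃ (C : G.ConnectedComponent) (X : CNode C),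
      X.IsBlockNode ∧ Names (x 0) (x 1) X}
  | .cutNode => {x : Fin 2 → V | ∃ (C : G.ConnectedComponent) (X : CNode C),
      X.IsCutNode ∧ Names (x 0) (x 1) X}
  | .sameNode => {x : Fin 4 → V | ∃ (C : G.ConnectedComponent) (X : CNode C),
      Names (x 0) (x 1) X ∧ Names (x 2) (x 3) X}
  | .vertexOf => {x : Fin 3 → V | ∃ (C : G.ConnectedComponent) (X : CNode C),
      Names (x 0) (x 1) X ∧ x 2 ∈ X.vertices}
  | .treeEdge => {x : Fin 4 → V | ∃ (C : G.ConnectedComponent) (X Y : CNode C),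
      Names (x 0) (x 1) X ∧ Names (x 2) (x 3) Y ∧ (tree C.toSimpleGraph).Adj X Y}
  | .between => {x : Fin 6 → V | ∃ (C : G.ConnectedComponent) (X Y Z : CNode C),
      Names (x 0) (x 1) X ∧ Names (x 2) (x 3) Y ∧ Names (x 4) (x 5) Z ∧ Between X Y Z}

/-- The relation as a query on input structures of dynamic programs. -/
def Rel.query (r : Rel) : DynFO.Query FirstOrder.Language.graph r.arity :=
  fun _ I => r.eval (DynFO.toGraph I)

end BCTree

/-! ### First-order definable predicates -/

/-! Everything about the BC-trees is first-order definable from adjacency and the ternary relation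
R(w, x, y): "x and y are connected in G without w". So it suffices to maintain R.

Maintaining R. For every w a spanning forest of G without w is kept, through the relation K(w, u, v,
x, y): x and y stay linked in that forest after removal of the edge uv. In a forest, a set of edges
separates x from y iff one of its members does, so K also answers queries about several removed
edges. When a single edge changes, the forest loses the deleted edge, if it had it, and then at most
one new edge is needed to span again. The choice has to be definable without an order on the domain.
For this the edges are ordered by time of insertion, and the least edge between two different trees
is added (`DescribesForests.update`).

From R to BC-trees. Distinct vertices a, b lie in a common block iff they are connected and no third
vertex separates them, and then the block consists of the vertices that are separated neither from a
nor from b (`isBlock_blockSet`, `IsBlock.eq_blockSet`). Paths of the tree need not be computed: a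
cut node v is between X and Z iff v separates X from Z (`between_cut_iff`), and a block is between
them iff it is one of the ends or contains two distinct cut vertices that both separate X from Z
(`between_block_iff`). `Rel.express_iff` transfers this to names of nodes and to the components of
G. The update rules are then assembled from closure properties of first-order definability. -/

namespace DynFO



section FirstOrderDefinable

variable {σ τ : FirstOrder.Language.{0, 0}} [σ.IsRelational] [τ.IsRelational]

/-- A predicate on tuples, given uniformly for all domains and all interpretations of the schemas
`σ` and `τ`. -/
abbrev Pred (σ τ : FirstOrder.Language.{0, 0}) (α : Type) : Type 1 :=
  (D : Type) → Interp σ D → Interp τ D → (α → D) → Prop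

/-- The predicate is defined by a single first-order formula. -/
def FODefinable {α : Type} (P : Pred σ τ α) : Prop :=
  ∃ φ : (σ.sum τ).Formula α, ∀ (D : Type) (I : Interp σ D) (A : Interp τ D) (x : α → D),
    (letI := I.toStructure
     let := A.toStructure
     φ.Realize x) ↔ P D I A x

namespace FODefinable

variable {α : Type} {P Q : Pred σ τ α}

theorem not (hP : FODefinable P) : FODefinable fun D I A x => ¬ P D I A x := by
  obtain ⟨φ, hφ⟩ := hP
  exact ⟨φ.not, fun D I A x => not_congr (hφ D I A x)⟩

theorem and (hP : FODefinable P) (hQ : FODefinable Q) :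
    FODefinable fun D I A x => P D I A x ∧ Q D I A x := by
  obtain ⟨φ, hφ⟩ := hP
  obtain ⟨ψ, hψ⟩ := hQ
  refine ⟨φ ⊓ ψ, fun D I A x => ?_⟩
  let := I.toStructure
  let := A.toStructure
  exact FirstOrder.Language.Formula.realize_inf.trans (and_congr (hφ D I A x) (hψ D I A x))

theorem congr (h : ∀ D I A x, P D I A x ↔ Q D I A x) (hP : FODefinable P) : FODefinable Q := by
  obtain ⟨φ, hφ⟩ := hP
  exact ⟨φ, fun D I A x => (hφ D I A x).trans (h D I A x)⟩

theorem imp (hP : FODefinable P) (hQ : FODefinable Q) :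
    FODefinable fun D I A x => P D I A x → Q D I A x :=
  congr (fun _ _ _ _ => by tauto) (hP.and hQ.not).not

theorem or (hP : FODefinable P) (hQ : FODefinable Q) :
    FODefinable fun D I A x => P D I A x ∨ Q D I A x :=
  congr (fun _ _ _ _ => by tauto) (hP.not.and hQ.not).not

theorem iff (hP : FODefinable P) (hQ : FODefinable Q) :
    FODefinable fun D I A x => P D I A x ↔ Q D I A x :=
  congr (fun _ _ _ _ => iff_def.symm) ((hP.imp hQ).and (hQ.imp hP))

/-- The variable `none` is the quantified one, and `some` embeds the free variables. Under nested
quantifiers the free variables therefore carry several `some`. -/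
theorem ex {P : (D : Type) → Interp σ D → Interp τ D → (α → D) → D → Prop}
    (hP : FODefinable (α := Option α) fun D I A x =>
      P D I A (fun i => x (some i)) (x none)) :
    FODefinable fun D I A x => ∃ d, P D I A x d := by
  obtain ⟨φ, hφ⟩ := hP
  let g : Option α → α ⊕ Unit := fun o => o.elim (.inr ()) .inl
  refine ⟨(φ.relabel g).iExs Unit, fun D I A x => ?_⟩
  let := I.toStructure
  let := A.toStructure
  refine FirstOrder.Language.Formula.realize_iExs.trans ⟨?_, ?_⟩
  · rintro ⟨i, hi⟩
    exact ⟨i (), (hφ D I A _).1 (FirstOrder.Language.Formula.realize_relabel.1 hi)⟩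
  · rintro ⟨d, hd⟩
    refine ⟨fun _ => d, FirstOrder.Language.Formula.realize_relabel.2 ?_⟩
    exact (hφ D I A (Sum.elim x (fun _ => d) ∘ g)).2 hd

theorem all {P : (D : Type) → Interp σ D → Interp τ D → (α → D) → D → Prop}
    (hP : FODefinable (α := Option α) fun D I A x =>
      P D I A (fun i => x (some i)) (x none)) :
    FODefinable fun D I A x => ∀ d, P D I A x d :=
  congr (fun _ _ _ _ => not_exists_not) (ex (P := fun D I A x d => ¬ P D I A x d) hP.not).not

theorem eq (i j : α) : FODefinable (σ := σ) (τ := τ) fun _ _ _ x => x i = x j :=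
  ⟨(FirstOrder.Language.Term.var i).equal (FirstOrder.Language.Term.var j), fun D I A x => by
    let := I.toStructure
    let := A.toStructure
    exact FirstOrder.Language.Formula.realize_equal⟩

theorem input {n : ℕ} (R : σ.Relations n) (t : Fin n → α) :
    FODefinable (σ := σ) (τ := τ) fun _ I _ x => (fun i => x (t i)) ∈ I n R :=
  ⟨FirstOrder.Language.Relations.formula (L := σ.sum τ) (Sum.inl R)
      fun i => FirstOrder.Language.Term.var (t i),
    fun D I A x => by
      let := I.toStructure
      let := A.toStructure
      exact FirstOrder.Language.Formula.realize_rel⟩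

theorem aux {n : ℕ} (R : τ.Relations n) (t : Fin n → α) :
    FODefinable (σ := σ) (τ := τ) fun _ _ A x => (fun i => x (t i)) ∈ A n R :=
  ⟨FirstOrder.Language.Relations.formula (L := σ.sum τ) (Sum.inr R)
      fun i => FirstOrder.Language.Term.var (t i),
    fun D I A x => by
      let := I.toStructure
      let := A.toStructure
      exact FirstOrder.Language.Formula.realize_rel⟩

end FODefinable

end FirstOrderDefinable

end DynFO
/-! ### Spanning forests -/

namespace DynFO

open SimpleGraph

section SpanningForest

variable {V : Type}

/-- The graph `G` without the edges at the vertex `w`. -/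
def avoid (G : SimpleGraph V) (w : V) : SimpleGraph V where
  Adj x y := G.Adj x y ∧ x ≠ w ∧ y ≠ w
  symm := ⟨fun _ _ h => ⟨h.1.symm, h.2.2, h.2.1⟩⟩
  loopless := ⟨fun _ h => h.1.ne rfl⟩

theorem avoid_le (G : SimpleGraph V) (w : V) : avoid G w ≤ G := fun _ _ h => h.1

theorem reachable_of_adj_reachable {G H : SimpleGraph V}
    (h : ∀ x y, G.Adj x y → H.Reachable x y) {x y : V} (hxy : G.Reachable x y) :
    H.Reachable x y := by
  obtain ⟨p⟩ := hxy
  induction p with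
  | nil => rfl
  | cons hadj _ ih => exact (h _ _ hadj).trans ih

/-- A walk needs to use the new edge at most once, in one of its two directions. This is what turns
the addition of an edge into a first-order update. -/
theorem reachable_sup_edge_iff (G : SimpleGraph V) (a b x y : V) :
    (G ⊔ edge a b).Reachable x y ↔ G.Reachable x y ∨ (G.Reachable x a ∧ G.Reachable b y) ∨
      (G.Reachable x b ∧ G.Reachable a y) := by
  have hab : (G ⊔ edge a b).Reachable a b := by
    by_cases h : a = b
    · rw [h]
    · exact Adj.reachable (Or.inr (by simp [edge_adj, h]))
  constructor
  · rintro ⟨p⟩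
    induction p with
    | nil => exact Or.inl (Reachable.refl _)
    | @cons u v w hadj _ ih =>
      rcases hadj with h | h
      · have h := h.reachable
        rcases ih with ih | ⟨h1, h2⟩ | ⟨h1, h2⟩
        · exact Or.inl (h.trans ih)
        · exact Or.inr (Or.inl ⟨h.trans h1, h2⟩)
        · exact Or.inr (Or.inr ⟨h.trans h1, h2⟩)
      · rw [edge_adj] at h
        rcases h.1 with ⟨rfl, rfl⟩ | ⟨rfl, rfl⟩
        · rcases ih with ih | ⟨h1, h2⟩ | ⟨h1, h2⟩
          · exact Or.inr (Or.inl ⟨.refl _, ih⟩)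
          · exact Or.inr (Or.inl ⟨.refl _, h2⟩)
          · exact Or.inl h2
        · rcases ih with ih | ⟨h1, h2⟩ | ⟨h1, h2⟩
          · exact Or.inr (Or.inr ⟨.refl _, ih⟩)
          · exact Or.inl h2
          · exact Or.inr (Or.inr ⟨.refl _, h2⟩)
  · rintro (h | ⟨h1, h2⟩ | ⟨h1, h2⟩)
    · exact h.mono le_sup_left
    · exact ((h1.mono le_sup_left).trans hab).trans (h2.mono le_sup_left)
    · exact ((h1.mono le_sup_left).trans hab.symm).trans (h2.mono le_sup_left)

/-- In a forest, two vertices stay connected when edges are deleted iff each single deletion leaves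
them connected. -/
theorem reachable_deleteEdges_iff {F : SimpleGraph V} (hF : F.IsAcyclic) (S : Set (Sym2 V))
    (x y : V) : (F.deleteEdges S).Reachable x y ↔
      F.Reachable x y ∧ ∀ e ∈ S, (F.deleteEdges {e}).Reachable x y := by
  classical
  constructor
  · exact fun h => ⟨h.mono (deleteEdges_le _), fun e he =>
      h.mono (deleteEdges_anti (Set.singleton_subset_iff.2 he))⟩
  · rintro ⟨⟨p⟩, h⟩
    refine ⟨p.bypass.toDeleteEdges S fun e hep heS => ?_⟩
    induction e with | _ u v
    obtain ⟨q, hq⟩ := reachable_deleteEdges_iff_exists_walk.1 (h _ heS)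
    -- Paths in a forest are unique, so the path of `p` is also the path of `q`, which misses the
    -- edge.
    have := (hF.subsingleton_path x y).elim ⟨_, p.bypass_isPath⟩ ⟨_, q.bypass_isPath⟩
    rw [Subtype.mk.injEq] at this
    rw [this] at hep
    exact hq (q.edges_bypass_subset_edges hep)

/-- `F` is a spanning forest of `H`. -/
structure IsSpanningForest (F H : SimpleGraph V) : Prop where
  le : F ≤ H
  acyclic : F.IsAcyclic
  spans : ∀ x y, H.Adj x y → F.Reachable x y

theorem IsSpanningForest.reachable_iff {F H : SimpleGraph V} (h : IsSpanningForest F H) {x y : V} :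
    F.Reachable x y ↔ H.Reachable x y :=
  ⟨fun hxy => hxy.mono h.le, reachable_of_adj_reachable h.spans⟩

/-- If a forest is spanning up to a single missing link, then any edge between different trees
of the forest completes it to a spanning forest. -/
theorem IsSpanningForest.sup_edge {F H : SimpleGraph V} (hle : F ≤ H) (hF : F.IsAcyclic) {a b : V}
    (hspan : ∀ x y, H.Adj x y → (F ⊔ edge a b).Reachable x y) {c d : V} (hcd : H.Adj c d)
    (hn : ¬ F.Reachable c d) : IsSpanningForest (F ⊔ edge c d) H where
  le := sup_le hle ((edge_le_iff _).2 (Or.inr hcd))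
  acyclic := hF.sup_edge_of_not_reachable hn
  spans x y hxy := by
    -- The ends of `cd` are joined only with the help of `ab`, so they lie in the trees of `a` and
    -- `b`, one in each. Hence `cd` can play the role of `ab`.
    have h1 := (reachable_sup_edge_iff F a b c d).1 (hspan c d hcd)
    have h2 := (reachable_sup_edge_iff F a b x y).1 (hspan x y hxy)
    rw [reachable_sup_edge_iff]
    rcases h1 with h1 | ⟨h1, h1'⟩ | ⟨h1, h1'⟩
    · exact absurd h1 hn
    · rcases h2 with h2 | ⟨h2, h2'⟩ | ⟨h2, h2'⟩
      · exact Or.inl h2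
      · exact Or.inr (Or.inl ⟨h2.trans h1.symm, h1'.symm.trans h2'⟩)
      · exact Or.inr (Or.inr ⟨h2.trans h1', h1.trans h2'⟩)
    · rcases h2 with h2 | ⟨h2, h2'⟩ | ⟨h2, h2'⟩
      · exact Or.inl h2
      · exact Or.inr (Or.inr ⟨h2.trans h1', h1.trans h2'⟩)
      · exact Or.inr (Or.inl ⟨h2.trans h1.symm, h1'.symm.trans h2'⟩)

end SpanningForest

/-! ### Dynamic reachability in the graphs without a vertex

`E` and `E'` are the edge relations before and after a change, `O` is a relation that orders the
edges, and `K w u v x y` says that `x ≠ y` are linked in the spanning forest of the graph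
without `w`, when the edge between `u` and `v` is deleted from that forest. -/

section Update

variable {V : Type} (E E' : V → V → Prop) (O : V → V → V → V → Prop)
  (K : V → V → V → V → V → Prop)

/-- The order of the edges after the change: a new edge is above all old ones. -/
def newOrder (a b c d : V) : Prop :=
  ¬ (E' a b ∧ ¬ E a b) ∧ ((E' c d ∧ ¬ E c d) ∨ O a b c d)

/-- `K`, completed to a reflexive relation. -/
def reflLink (w u v x y : V) : Prop := x = y ∨ K w u v x y

/-- Links in the old forests without the deleted edges. -/
def oldLink (w u v x y : V) : Prop :=
  reflLink K w u v x y ∧ ∀ a b, E a b ∧ ¬ E' a b → reflLink K w a b x y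

/-- The edges that connect different trees of the forest which has lost the deleted edges. -/
def Crossing (w c d : V) : Prop :=
  E' c d ∧ c ≠ w ∧ d ≠ w ∧ ¬ oldLink E E' K w w w c d

/-- The edge by which the forest is repaired. -/
def Repair (w c d : V) : Prop :=
  Crossing E E' K w c d ∧ ∀ a b, Crossing E E' K w a b → ¬ newOrder E E' O a b c d

/-- The links in the repaired forests. -/
def newLink (w u v x y : V) : Prop :=
  oldLink E E' K w u v x y ∨ ∃ c d, Repair E E' O K w c d ∧
    ¬ ((u = c ∧ v = d) ∨ (u = d ∧ v = c)) ∧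
    oldLink E E' K w u v x c ∧ oldLink E E' K w u v d y

variable {E E' O K}

/-- The relation `O` orders the edges of `G` linearly. -/
def OrdersEdges (G : SimpleGraph V) (O : V → V → V → V → Prop) : Prop :=
  ∃ r : Sym2 V → ℕ, Set.InjOn r G.edgeSet ∧
    ∀ a b c d, G.Adj a b → G.Adj c d → (O a b c d ↔ r s(a, b) < r s(c, d))

/-- `K` describes spanning forests of the graphs `avoid G w`. -/
def DescribesForests (G : SimpleGraph V) (K : V → V → V → V → V → Prop) : Prop :=
  ∀ w, ∃ F, IsSpanningForest F (avoid G w) ∧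
    ∀ u v x y, reflLink K w u v x y ↔ (F.deleteEdges {s(u, v)}).Reachable x y

/-- The graphs `G` and `G'` differ in the edge between `a` and `b` at most. -/
def DifferAt (G G' : SimpleGraph V) (a b : V) : Prop :=
  ∀ x y, s(x, y) ≠ s(a, b) → (G.Adj x y ↔ G'.Adj x y)

variable {G G' : SimpleGraph V} {a b : V}

theorem OrdersEdges.update [Finite V] (hO : OrdersEdges G O) (h : DifferAt G G' a b) :
    OrdersEdges G' (newOrder G.Adj G'.Adj O) := by
  classical
  obtain ⟨r, hr, hrO⟩ := hO
  have hfin : (Set.range r).Finite := Set.finite_range r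
  obtain ⟨m, hm⟩ := hfin.bddAbove
  have hm : ∀ e, r e ≤ m := fun e => hm ⟨e, rfl⟩
  have hnew : ∀ e, e ∈ G'.edgeSet → e ∉ G.edgeSet → e = s(a, b) := by
    intro e he he'
    induction e with | _ x y
    by_contra hne
    exact he' ((h x y hne).2 he)
  -- Only one edge can be new, so a single rank above the bound `m` keeps the ranks injective. Ranks
  -- of pairs that are no longer edges do not matter.
  refine ⟨fun e => if e ∈ G.edgeSet then r e else m + 1, ?_, ?_⟩
  · intro e he f hf hef
    by_cases h1 : e ∈ G.edgeSet <;> by_cases h2 : f ∈ G.edgeSet <;> simp only [h1, h2, if_true,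
      if_false] at hef
    · exact hr h1 h2 hef
    · have := hm e; omega
    · have := hm f; omega
    · rw [hnew e he h1, hnew f hf h2]
  · intro c d x y hcd hxy
    have h1 := hm s(c, d)
    have h2 := hm s(x, y)
    by_cases hc : G.Adj c d <;> by_cases hx : G.Adj x y <;>
      simp [newOrder, hcd, hxy, hc, hx]
    · exact hrO _ _ _ _ hc hx
    · omega
    · omega

/-- `K` only tests single deletions. The forest property upgrades these tests to the simultaneous
deletion of `uv` and of all edges lost in the change. -/
theorem oldLink_iff {F : SimpleGraph V} {w : V} (hF : F.IsAcyclic)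
    (hK : ∀ u v x y, reflLink K w u v x y ↔ (F.deleteEdges {s(u, v)}).Reachable x y)
    (u v x y : V) : oldLink G.Adj G'.Adj K w u v x y ↔
      ((F.deleteEdges (G.edgeSet \ G'.edgeSet)).deleteEdges {s(u, v)}).Reachable x y := by
  rw [deleteEdges_deleteEdges, reachable_deleteEdges_iff hF]
  simp only [oldLink, hK]
  constructor
  · rintro ⟨h1, h2⟩
    refine ⟨h1.mono (deleteEdges_le _), fun e he => ?_⟩
    induction e with | _ c d
    rcases he with he | he
    · exact h2 c d he
    · rw [Set.mem_singleton_iff.1 he]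
      exact h1
  · rintro ⟨-, h2⟩
    exact ⟨h2 _ (Or.inr rfl), fun c d hcd => h2 s(c, d) (Or.inl hcd)⟩

/-- The diagonal pair is never an edge, so the arguments `u = v` of `K` recover connectivity in the
undamaged forest. -/
theorem deleteEdges_diag (F : SimpleGraph V) (w : V) : F.deleteEdges {s(w, w)} = F := by
  ext x y
  simp only [deleteEdges_adj, Set.mem_singleton_iff, and_iff_left_iff_imp]
  intro h he
  rw [Sym2.eq_iff] at he
  rcases he with ⟨rfl, rfl⟩ | ⟨rfl, rfl⟩ <;> exact h.ne rfl

/-- Insertions and deletions are treated alike: the forest `F₁` without the lost edges would span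
the new graph if the link `ab` were added to it, whether or not `ab` is still an edge. So either
`F₁` already spans, or any crossing edge of the new graph repairs it, and the least one is taken. -/
theorem DescribesForests.update [Finite V] (hO : OrdersEdges G O) (hK : DescribesForests G K)
    (h : DifferAt G G' a b) (w : V) : ∃ F, IsSpanningForest F (avoid G' w) ∧
      ∀ u v x y, newLink G.Adj G'.Adj O K w u v x y ↔
        (F.deleteEdges {s(u, v)}).Reachable x y := by
  classical
  obtain ⟨F, hF, hFK⟩ := hK w
  obtain ⟨r, hr, hrO⟩ := hO.update h
  set F₁ := F.deleteEdges (G.edgeSet \ G'.edgeSet) with hF₁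
  have hold : ∀ u v x y, oldLink G.Adj G'.Adj K w u v x y ↔
      (F₁.deleteEdges {s(u, v)}).Reachable x y := oldLink_iff hF.acyclic hFK
  have hle : F₁ ≤ avoid G' w := by
    intro x y hxy
    rw [hF₁, deleteEdges_adj] at hxy
    have := hF.le hxy.1
    exact ⟨by_contra fun hn => hxy.2 ⟨this.1, hn⟩, this.2⟩
  have hac : F₁.IsAcyclic := hF.acyclic.anti (deleteEdges_le _)
  have hF_le : F ≤ F₁ ⊔ edge a b := by
    intro x y hxy
    by_cases hs : s(x, y) = s(a, b)
    · right
      rw [edge_adj]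
      exact ⟨Sym2.eq_iff.1 hs, hxy.ne⟩
    · left
      rw [hF₁, deleteEdges_adj]
      exact ⟨hxy, fun hm => hm.2 ((h x y hs).1 hm.1)⟩
  have hspan : ∀ x y, (avoid G' w).Adj x y → (F₁ ⊔ edge a b).Reachable x y := by
    intro x y hxy
    by_cases hs : s(x, y) = s(a, b)
    · refine Adj.reachable (Or.inr ?_)
      rw [edge_adj]
      exact ⟨Sym2.eq_iff.1 hs, hxy.1.ne⟩
    · exact (hF.spans x y ⟨(h x y hs).2 hxy.1, hxy.2⟩).mono hF_le
  have hcross : ∀ c d, Crossing G.Adj G'.Adj K w c d ↔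
      (avoid G' w).Adj c d ∧ ¬ F₁.Reachable c d := by
    intro c d
    rw [Crossing, hold, deleteEdges_diag]
    exact ⟨fun h => ⟨⟨h.1, h.2.1, h.2.2.1⟩, h.2.2.2⟩, fun h => ⟨h.1.1, h.1.2.1, h.1.2.2, h.2⟩⟩
  by_cases hex : ∃ e : V × V, Crossing G.Adj G'.Adj K w e.1 e.2
  · obtain ⟨⟨c, d⟩, hcd, hmin⟩ := Set.exists_min_image
      {e : V × V | Crossing G.Adj G'.Adj K w e.1 e.2} (fun e => r s(e.1, e.2)) (Set.toFinite _) hex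
    have hcd' := (hcross c d).1 hcd
    have hrep : Repair G.Adj G'.Adj O K w c d := by
      refine ⟨hcd, fun x y hxy hlt => ?_⟩
      rw [hrO _ _ _ _ hxy.1 hcd.1] at hlt
      exact absurd (hmin (x, y) hxy) (not_le.2 hlt)
    -- Ranks are injective on edges, so the least crossing edge is unique up to orientation.
    have huniq : ∀ x y, Repair G.Adj G'.Adj O K w x y → s(x, y) = s(c, d) := by
      rintro x y ⟨hxy, hxy'⟩
      refine hr hxy.1 hcd.1 (le_antisymm ?_ (hmin (x, y) hxy))
      have := hxy' c d hcd
      rw [hrO _ _ _ _ hcd.1 hxy.1] at this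
      exact not_lt.1 this
    -- `Repair` holds for both orientations; together they account for the two directions in which a
    -- path can use the repairing edge.
    have hrep' : Repair G.Adj G'.Adj O K w d c := by
      refine ⟨(hcross d c).2 ⟨hcd'.1.symm, fun h => hcd'.2 h.symm⟩, fun x y hxy hlt => ?_⟩
      rw [hrO _ _ _ _ hxy.1 hcd.1.symm, Sym2.eq_swap (a := d)] at hlt
      exact absurd (hmin (x, y) hxy) (not_le.2 hlt)
    refine ⟨F₁ ⊔ edge c d, .sup_edge hle hac hspan hcd'.1 hcd'.2, fun u v x y => ?_⟩
    -- If the deleted edge is the repairing edge itself, the repair is undone and only the old links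
    -- remain.
    by_cases huv : s(u, v) = s(c, d)
    · have hdel : (F₁ ⊔ edge c d).deleteEdges {s(u, v)} = F₁.deleteEdges {s(u, v)} := by
        ext p q
        simp only [deleteEdges_adj, sup_adj, edge_adj, Set.mem_singleton_iff, huv]
        constructor
        · rintro ⟨h1 | h1, h2⟩
          · exact ⟨h1, h2⟩
          · exact absurd (Sym2.eq_iff.2 h1.1) h2
        · exact fun h => ⟨Or.inl h.1, h.2⟩
      rw [hdel, ← hold]
      refine ⟨?_, Or.inl⟩
      rintro (h1 | ⟨x', y', h1, h2, -⟩)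
      · exact h1
      · exact absurd (Sym2.eq_iff.1 (huv.trans (huniq _ _ h1).symm)) h2
    · have hdel : (F₁ ⊔ edge c d).deleteEdges {s(u, v)} = F₁.deleteEdges {s(u, v)} ⊔ edge c d := by
        ext p q
        simp only [deleteEdges_adj, sup_adj, edge_adj, Set.mem_singleton_iff]
        constructor
        · rintro ⟨h1 | h1, h2⟩
          · exact Or.inl ⟨h1, h2⟩
          · exact Or.inr h1
        · rintro (h1 | h1)
          · exact ⟨Or.inl h1.1, h1.2⟩
          · exact ⟨Or.inr h1, fun h2 => huv (h2.symm.trans (Sym2.eq_iff.2 h1.1))⟩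
      rw [hdel, reachable_sup_edge_iff]
      simp only [newLink, hold]
      refine or_congr_right ⟨?_, ?_⟩
      · rintro ⟨x', y', h1, -, h2, h3⟩
        rcases Sym2.eq_iff.1 (huniq _ _ h1) with ⟨rfl, rfl⟩ | ⟨rfl, rfl⟩
        · exact Or.inl ⟨h2, h3⟩
        · exact Or.inr ⟨h2, h3⟩
      · rintro (h1 | h1)
        · exact ⟨c, d, hrep, fun h2 => huv (Sym2.eq_iff.2 h2), h1⟩
        · exact ⟨d, c, hrep', fun h2 => huv (Sym2.eq_iff.2 h2.symm), h1⟩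
  · refine ⟨F₁, ⟨hle, hac, fun x y hxy => by_contra fun hn => hex ⟨(x, y), ?_⟩⟩, fun u v x y => ?_⟩
    · exact (hcross x y).2 ⟨hxy, hn⟩
    · rw [← hold]
      refine ⟨?_, Or.inl⟩
      rintro (h1 | ⟨c, d, h1, -⟩)
      · exact h1
      · exact absurd ⟨(c, d), h1.1⟩ hex

/-- Reachability in `G'` without `w` in terms of the repaired forests. -/
theorem newLink_diag_iff [Finite V] (hO : OrdersEdges G O) (hK : DescribesForests G K)
    (h : DifferAt G G' a b) (w x y : V) :
    newLink G.Adj G'.Adj O K w w w x y ↔ (avoid G' w).Reachable x y := by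
  obtain ⟨F, hF, hFK⟩ := hK.update hO h w
  rw [hFK, deleteEdges_diag, hF.reachable_iff]

end Update

end DynFO
/-! ### Blocks and separating vertices -/

namespace BCTree

open SimpleGraph DynFO

section Blocks

variable {W : Type} {H : SimpleGraph W}

theorem reachable_avoid_of_walk {x y v : W} (p : H.Walk x y) (hv : v ∉ p.support) :
    (avoid H v).Reachable x y := by
  induction p with
  | nil => rfl
  | cons hadj p ih =>
    rw [Walk.support_cons, List.mem_cons, not_or] at hv
    refine Reachable.trans (Adj.reachable ⟨hadj, Ne.symm hv.1, ?_⟩) (ih hv.2)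
    rintro rfl
    exact hv.2 p.start_mem_support

/-- In `avoid H v` the vertex `v` survives as an isolated vertex; `hx` excludes the trivial walk at
`v`. -/
theorem exists_walk_of_reachable_avoid {x y v : W} (hx : x ≠ v)
    (h : (avoid H v).Reachable x y) : ∃ p : H.Walk x y, v ∉ p.support := by
  obtain ⟨p⟩ := h
  induction p with
  | nil => exact ⟨.nil, by simpa using hx.symm⟩
  | cons hadj p ih =>
    obtain ⟨q, hq⟩ := ih hadj.2.2
    exact ⟨.cons hadj.1 q, by simpa using ⟨hx.symm, hq⟩⟩

theorem exists_path_of_reachable_avoid {x y v : W} (hx : x ≠ v)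
    (h : (avoid H v).Reachable x y) : ∃ p : H.Walk x y, p.IsPath ∧ v ∉ p.support := by
  classical
  obtain ⟨p, hp⟩ := exists_walk_of_reachable_avoid hx h
  exact ⟨p.bypass, p.bypass_isPath, fun hv => hp (p.support_bypass_subset_support hv)⟩

theorem reachable_induce_of_walk {S : Set W} {x y : W} (p : H.Walk x y)
    (hp : ∀ z ∈ p.support, z ∈ S) (hx : x ∈ S) (hy : y ∈ S) :
    (H.induce S).Reachable ⟨x, hx⟩ ⟨y, hy⟩ :=
  ⟨p.induce S hp⟩

theorem reachable_induce_compl_iff {v x y : W} (hx : x ≠ v) (hy : y ≠ v) :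
    (H.induce {v}ᶜ).Reachable ⟨x, hx⟩ ⟨y, hy⟩ ↔ (avoid H v).Reachable x y := by
  constructor
  · intro h
    exact h.map (G' := avoid H v) ⟨Subtype.val, fun {a b} hab => ⟨hab, a.2, b.2⟩⟩
  · intro h
    obtain ⟨p, hp⟩ := exists_walk_of_reachable_avoid hx h
    exact reachable_induce_of_walk p (fun z hz (hzv : z = v) => hp (hzv ▸ hz)) hx hy

theorem isCutVertex_iff (hH : H.Connected) {v : W} :
    IsCutVertex H v ↔ ∃ x y, x ≠ v ∧ y ≠ v ∧ ¬ (avoid H v).Reachable x y := by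
  rw [IsCutVertex, and_iff_right hH, Preconnected]
  push Not
  constructor
  · rintro ⟨⟨x, hx⟩, ⟨y, hy⟩, h⟩
    exact ⟨x, y, hx, hy, fun h' => h ((reachable_induce_compl_iff hx hy).2 h')⟩
  · rintro ⟨x, y, hx, hy, h⟩
    exact ⟨⟨x, hx⟩, ⟨y, hy⟩, fun h' => h ((reachable_induce_compl_iff hx hy).1 h')⟩

/-- No single vertex separates `a` from `b`. -/
def NonSep (H : SimpleGraph W) (a b : W) : Prop :=
  ∀ v, v ≠ a → v ≠ b → (avoid H v).Reachable a b

theorem NonSep.refl (a : W) : NonSep H a a := fun _ _ _ => .refl _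

theorem NonSep.symm {a b : W} (h : NonSep H a b) : NonSep H b a :=
  fun v hb ha => (h v ha hb).symm

theorem NonSep.of_adj {a b : W} (h : H.Adj a b) : NonSep H a b :=
  fun _ ha hb => Adj.reachable ⟨h, ha.symm, hb.symm⟩

/-- A vertex of `S` does not separate because it is no cut vertex there; a vertex outside of `S` is
avoided by every walk inside `S`. -/
theorem NonSep.of_biconnected {S : Set W} (hS : Biconnected (H.induce S)) {a b : W} (ha : a ∈ S)
    (hb : b ∈ S) : NonSep H a b := by
  intro v hva hvb
  by_cases hv : v ∈ S
  · have h := hS.2 ⟨v, hv⟩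
    rw [isCutVertex_iff hS.1] at h
    push Not at h
    exact (h ⟨a, ha⟩ ⟨b, hb⟩ (by simpa using hva.symm) (by simpa using hvb.symm)).map
      (G' := avoid H v) ⟨Subtype.val, fun {x y}
        (hxy : (avoid (H.induce S) ⟨v, hv⟩).Adj x y) => ⟨hxy.1,
          fun h => hxy.2.1 (Subtype.ext h), fun h => hxy.2.2 (Subtype.ext h)⟩⟩
  · exact (hS.1.preconnected ⟨a, ha⟩ ⟨b, hb⟩).map (G' := avoid H v) ⟨Subtype.val,
      fun {x y} hxy => ⟨hxy, fun h => hv (h ▸ x.2), fun h => hv (h ▸ y.2)⟩⟩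

/-- A path between vertices that are not separated from `a` consists of such vertices. -/
theorem NonSep.of_mem_path {a c d z : W} (hc : NonSep H a c) (hd : NonSep H a d) (p : H.Walk c d)
    (hp : p.IsPath) (hz : z ∈ p.support) : NonSep H a z := by
  classical
  intro v hva hvz
  -- As `v ≠ z`, at most one of the two halves of the path meets `v`. The other half leads from `z`
  -- to `c` or `d`, and from there to `a`.
  by_cases h : v ∈ (p.takeUntil z hz).support
  · have h' : v ∉ (p.dropUntil z hz).support := by
      intro h'
      have hp' : ((p.takeUntil z hz).append (p.dropUntil z hz)).IsPath := by
        rwa [p.take_spec hz]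
      exact hp'.ne_of_mem_support_of_append hvz h h' rfl
    have hvd : v ≠ d := by
      rintro rfl
      exact h' (Walk.end_mem_support _)
    exact (hd v hva hvd).trans (reachable_avoid_of_walk _ h').symm
  · have hvc : v ≠ c := by
      rintro rfl
      exact h (Walk.start_mem_support _)
    exact (hc v hva hvc).trans (reachable_avoid_of_walk _ h)

/-- The block that contains `a` and `b`. -/
def blockSet (H : SimpleGraph W) (a b : W) : Set W := {c | NonSep H a c ∧ NonSep H b c}

/-- A separating vertex differs from `a` or from `b`, and `c` and `d` are linked through that one.
-/
theorem nonSep_of_mem_blockSet {a b c d : W} (hab : a ≠ b) (hc : c ∈ blockSet H a b)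
    (hd : d ∈ blockSet H a b) : NonSep H c d := by
  intro v hvc hvd
  by_cases hva : v = a
  · have hvb : v ≠ b := fun h => hab (hva.symm.trans h)
    exact (hc.2 v hvb hvc).symm.trans (hd.2 v hvb hvd)
  · exact (hc.1 v hva hvc).symm.trans (hd.1 v hva hvd)

/-- The set contains every path of `H` between its members. Paths that witness connectivity in `H`,
with or without a vertex `v`, are therefore paths of the induced subgraph. -/
theorem biconnected_blockSet (hH : H.Connected) {a b : W} (hab : a ≠ b) (h : NonSep H a b) :
    Biconnected (H.induce (blockSet H a b)) := by
  classical
  have hconv : ∀ {c d : W}, c ∈ blockSet H a b → d ∈ blockSet H a b → ∀ p : H.Walk c d,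
      p.IsPath → ∀ z ∈ p.support, z ∈ blockSet H a b := fun hc hd p hp z hz =>
    ⟨.of_mem_path hc.1 hd.1 p hp hz, .of_mem_path hc.2 hd.2 p hp hz⟩
  have hconn : (H.induce (blockSet H a b)).Connected := by
    have : Nonempty (blockSet H a b) := ⟨⟨a, .refl a, h.symm⟩⟩
    refine ⟨fun ⟨c, hc⟩ ⟨d, hd⟩ => ?_⟩
    obtain ⟨p⟩ := hH.preconnected c d
    exact reachable_induce_of_walk p.bypass (hconv hc hd _ p.bypass_isPath) hc hd
  refine ⟨hconn, fun ⟨v, hv⟩ hcut => ?_⟩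
  rw [isCutVertex_iff hconn] at hcut
  obtain ⟨⟨c, hc⟩, ⟨d, hd⟩, hcv, hdv, hn⟩ := hcut
  have hcv' : c ≠ v := fun e => hcv (Subtype.ext e)
  have hdv' : d ≠ v := fun e => hdv (Subtype.ext e)
  obtain ⟨p, hp, hpv⟩ := exists_path_of_reachable_avoid hcv'
    (nonSep_of_mem_blockSet hab hc hd v hcv'.symm hdv'.symm)
  refine hn (reachable_avoid_of_walk (p.induce _ (hconv hc hd p hp)) fun hmem => hpv ?_)
  have := List.mem_map_of_mem (f := Subtype.val) hmem
  rwa [p.support_induce, List.attachWith_map_subtype_val] at this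

theorem isBlock_blockSet (hH : H.Connected) {a b : W} (hab : a ≠ b) (h : NonSep H a b) :
    IsBlock H (blockSet H a b) :=
  ⟨biconnected_blockSet hH hab h, fun _ hS hle _ hc =>
    ⟨.of_biconnected hS (hle ⟨.refl a, h.symm⟩) hc, .of_biconnected hS (hle ⟨h, .refl b⟩) hc⟩⟩

theorem IsBlock.nonSep {B : Set W} (hB : IsBlock H B) {a b : W} (ha : a ∈ B) (hb : b ∈ B) :
    NonSep H a b :=
  .of_biconnected hB.prop ha hb

/-- Two distinct vertices determine their block, which is why pairs can serve as names. -/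
theorem IsBlock.eq_blockSet (hH : H.Connected) {B : Set W} (hB : IsBlock H B) {a b : W}
    (ha : a ∈ B) (hb : b ∈ B) (hab : a ≠ b) : B = blockSet H a b :=
  hB.eq_of_subset (biconnected_blockSet hH hab (hB.nonSep ha hb))
    fun _ hc => ⟨hB.nonSep ha hc, hB.nonSep hb hc⟩

theorem IsBlock.nonempty {B : Set W} (hB : IsBlock H B) : B.Nonempty :=
  Set.nonempty_coe_sort.1 hB.prop.1.nonempty

theorem exists_adj_of_ne (hH : H.Connected) {u v : W} (huv : v ≠ u) : ∃ w, H.Adj v w := by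
  obtain ⟨p⟩ := hH.preconnected v u
  cases p with
  | nil => exact absurd rfl huv
  | cons hadj _ => exact ⟨_, hadj⟩

/-- Otherwise `B` would be properly contained in the block of an edge at `v`. -/
theorem IsBlock.exists_ne (hH : H.Connected) {B : Set W} (hB : IsBlock H B) {u v : W}
    (huv : v ≠ u) : ∃ w ∈ B, w ≠ v := by
  by_contra! hn
  obtain ⟨w, hw⟩ := exists_adj_of_ne hH huv
  have hle : B ⊆ blockSet H v w := fun x hx => by
    rw [hn x hx]
    exact ⟨.refl v, (NonSep.of_adj hw).symm⟩
  have := hB.eq_of_subset (biconnected_blockSet hH hw.ne (.of_adj hw)) hle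
  exact hw.ne (hn w (this ▸ ⟨.of_adj hw, .refl w⟩)).symm

theorem isBlock_singleton {v : W} (h : ∀ u, u = v) : IsBlock H {v} := by
  refine ⟨⟨?_, fun w hw => hw.2 ?_⟩, fun _ _ _ u _ => h u⟩
  · have : Nonempty ({v} : Set W) := ⟨⟨v, rfl⟩⟩
    exact ⟨fun x y => by rw [Subsingleton.elim x y]⟩
  · intro x
    exact absurd (Subsingleton.elim x.1 w) x.2

theorem IsCutVertex.exists_ne {v : W} (hv : IsCutVertex H v) : ∃ u, v ≠ u := by
  obtain ⟨x, -, hx, -⟩ := (isCutVertex_iff hv.1).1 hv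
  exact ⟨x, hx.symm⟩

/-- Blocks that share the vertex `v` are separated by it, unless they coincide. -/
theorem IsBlock.eq_of_reachable_avoid (hH : H.Connected) {B B' : Set W} (hB : IsBlock H B)
    (hB' : IsBlock H B') {v x y : W} (hv : v ∈ B) (hv' : v ∈ B') (hx : x ∈ B) (hy : y ∈ B')
    (hxv : x ≠ v) (hyv : y ≠ v) (h : (avoid H v).Reachable x y) : B = B' := by
  -- The vertex `v` does not separate by assumption; any other vertex is bypassed via `v`, through
  -- the two blocks.
  have hxy : NonSep H x y := by
    intro u hux huy
    by_cases huv : u = v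
    · exact huv ▸ h
    · exact (hB.nonSep hx hv u hux huv).trans (hB'.nonSep hv' hy u huv huy)
  have hyB : y ∈ B := by
    rw [hB.eq_blockSet hH hv hx hxv.symm]
    exact ⟨hB'.nonSep hv' hy, hxy⟩
  rw [hB.eq_blockSet hH hv hyB hyv.symm, hB'.eq_blockSet hH hv' hy hyv.symm]

theorem isCutVertex_of_mem_blocks (hH : H.Connected) {B B' : Set W} (hB : IsBlock H B)
    (hB' : IsBlock H B') {v : W} (hv : v ∈ B) (hv' : v ∈ B') (hne : B ≠ B') :
    IsCutVertex H v := by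
  by_cases h : ∃ u, v ≠ u
  · obtain ⟨u, hu⟩ := h
    obtain ⟨x, hx, hxv⟩ := hB.exists_ne hH hu
    obtain ⟨y, hy, hyv⟩ := hB'.exists_ne hH hu
    exact (isCutVertex_iff hH).2 ⟨x, y, hxv, hyv, fun h =>
      hne (hB.eq_of_reachable_avoid hH hB' hv hv' hx hy hxv hyv h)⟩
  · push Not at h
    refine absurd ?_ hne
    ext x
    rw [← h x]
    exact iff_of_true hv hv'

end Blocks

/-! ### Betweenness in the BC-tree -/

section Tree

variable {W : Type} {H : SimpleGraph W}

theorem tree_adj_cut_block {v : W} {hv : IsCutVertex H v} {B : Set W} {hB : IsBlock H B} :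
    (tree H).Adj (.cut v hv) (.block B hB) ↔ v ∈ B := by
  simp [tree]

theorem tree_not_adj_cut_cut {v v' : W} {hv : IsCutVertex H v} {hv' : IsCutVertex H v'} :
    ¬ (tree H).Adj (.cut v hv) (.cut v' hv') := by
  simp [tree]

theorem tree_not_adj_block_block {B B' : Set W} {hB : IsBlock H B} {hB' : IsBlock H B'} :
    ¬ (tree H).Adj (.block B hB) (.block B' hB') := by
  simp [tree]

theorem Node.nonSep (X : Node H) {a b : W} (ha : a ∈ X.verts) (hb : b ∈ X.verts) :
    NonSep H a b := by
  cases X with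
  | block B hB => exact hB.nonSep ha hb
  | cut v hv =>
    obtain rfl : a = v := ha
    obtain rfl : b = a := hb
    exact .refl _

theorem Node.exists_ne (hH : H.Connected) {v : W} (hv : IsCutVertex H v) {X : Node H}
    (hX : X ≠ .cut v hv) : ∃ x ∈ X.verts, x ≠ v := by
  cases X with
  | block B hB => exact hB.exists_ne hH hv.exists_ne.choose_spec
  | cut w hw => exact ⟨w, rfl, fun h => hX (by subst h; rfl)⟩

/-- The walk in `H` is followed edge by edge. Each edge lies in a block, and successive blocks share
a vertex, so they coincide or are joined by a cut node. -/
theorem reachable_block_block (hH : H.Connected) {b b' : W} (p : H.Walk b b') {B B' : Set W}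
    (hB : IsBlock H B) (hB' : IsBlock H B') (hb : b ∈ B) (hb' : b' ∈ B') :
    (tree H).Reachable (.block B hB) (.block B' hB') := by
  have key : ∀ {v : W} {A A' : Set W} (hA : IsBlock H A) (hA' : IsBlock H A'), v ∈ A → v ∈ A' →
      (tree H).Reachable (.block A hA) (.block A' hA') := by
    intro v A A' hA hA' hv hv'
    by_cases hne : A = A'
    · subst hne
      rfl
    · have hcut := isCutVertex_of_mem_blocks hH hA hA' hv hv' hne
      exact ((tree_adj_cut_block (hv := hcut)).2 hv).reachable.symm.trans
        ((tree_adj_cut_block (hv := hcut)).2 hv').reachable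
  induction p generalizing B with
  | nil => exact key hB hB' hb hb'
  | cons hadj p ih =>
    have hA := isBlock_blockSet hH hadj.ne (.of_adj hadj)
    exact (key hB hA hb ⟨.refl _, (NonSep.of_adj hadj).symm⟩).trans
      (ih hA ⟨.of_adj hadj, .refl _⟩ hb')

theorem Node.exists_reachable_block (hH : H.Connected) (X : Node H) :
    ∃ (B : Set W) (hB : IsBlock H B), (tree H).Reachable X (.block B hB) := by
  cases X with
  | block B hB => exact ⟨B, hB, .refl _⟩
  | cut v hv =>
    obtain ⟨w, hw⟩ := exists_adj_of_ne hH hv.exists_ne.choose_spec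
    have hmem : v ∈ blockSet H v w := ⟨.refl v, (NonSep.of_adj hw).symm⟩
    exact ⟨_, isBlock_blockSet hH hw.ne (.of_adj hw), (tree_adj_cut_block.2 hmem).reachable⟩

theorem tree_preconnected (hH : H.Connected) : (tree H).Preconnected := by
  intro X Y
  obtain ⟨B, hB, h⟩ := X.exists_reachable_block hH
  obtain ⟨B', hB', h'⟩ := Y.exists_reachable_block hH
  obtain ⟨b, hb⟩ := hB.nonempty
  obtain ⟨b', hb'⟩ := hB'.nonempty
  obtain ⟨p⟩ := hH.preconnected b b'
  exact (h.trans (reachable_block_block hH p hB hB' hb hb')).trans h'.symm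

theorem exists_path (hH : H.Connected) (X Z : Node H) : ∃ p : (tree H).Walk X Z, p.IsPath := by
  classical
  obtain ⟨p⟩ := tree_preconnected hH X Z
  exact ⟨p.bypass, p.bypass_isPath⟩

/-- Adjacent nodes share a cut vertex, which differs from `v` because the node of `v` is not
visited. Within a node nothing is separated by `v`, so the pieces can be concatenated. -/
theorem reachable_avoid_of_tree_walk {v : W} {hv : IsCutVertex H v} {X Z : Node H}
    (p : (tree H).Walk X Z) (hp : Node.cut v hv ∉ p.support) {x z : W} (hx : x ∈ X.verts)
    (hz : z ∈ Z.verts) (hxv : x ≠ v) (hzv : z ≠ v) : (avoid H v).Reachable x z := by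
  induction p generalizing x with
  | @nil X => exact X.nonSep hx hz v hxv.symm hzv.symm
  | @cons X Y Z hadj p ih =>
    rw [Walk.support_cons, List.mem_cons, not_or] at hp
    obtain ⟨c, hcX, hcY, hcv⟩ : ∃ c, c ∈ X.verts ∧ c ∈ Y.verts ∧ c ≠ v := by
      cases X with
      | block B hB =>
        cases Y with
        | block B' hB' => exact absurd hadj tree_not_adj_block_block
        | cut c hc =>
          refine ⟨c, tree_adj_cut_block.1 hadj.symm, rfl, ?_⟩
          rintro rfl
          exact hp.2 p.start_mem_support
      | cut c hc =>
        cases Y with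
        | block B' hB' =>
          refine ⟨c, rfl, tree_adj_cut_block.1 hadj, ?_⟩
          rintro rfl
          exact hp.1 rfl
        | cut c' hc' => exact absurd hadj tree_not_adj_cut_cut
    exact (X.nonSep hx hcX v hxv.symm hcv.symm).trans (ih hp.2 hcY hz hcv)

/-- The vertex `v` separates the node `X` from the node `Z`. -/
def Separates (v : W) (X Z : Node H) : Prop :=
  ∀ x ∈ X.verts, ∀ z ∈ Z.verts, x ≠ v → z ≠ v → ¬ (avoid H v).Reachable x z

theorem Separates.mem_support (hH : H.Connected) {v : W} {hv : IsCutVertex H v} {X Z : Node H}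
    (h : Separates v X Z) (p : (tree H).Walk X Z) : Node.cut v hv ∈ p.support := by
  by_contra hn
  obtain ⟨x, hx, hxv⟩ := Node.exists_ne hH hv (X := X) fun h => hn (h ▸ p.start_mem_support)
  obtain ⟨z, hz, hzv⟩ := Node.exists_ne hH hv (X := Z) fun h => hn (h ▸ p.end_mem_support)
  exact h x hx z hz hxv hzv (reachable_avoid_of_tree_walk p hn hx hz hxv hzv)

/-- The block is the second node of the path. The rest of the path does not return to `v`, so it
translates into connections that avoid `v`. -/
theorem exists_block_of_path_from_cut {v : W} {hv : IsCutVertex H v} {Z : Node H}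
    (p : (tree H).Walk (.cut v hv) Z) (hp : p.IsPath) (hZ : .cut v hv ≠ Z) :
    ∃ (B : Set W) (hB : IsBlock H B), v ∈ B ∧ Node.block B hB ∈ p.support ∧
      ∀ b ∈ B, ∀ z ∈ Z.verts, b ≠ v → z ≠ v → (avoid H v).Reachable b z := by
  cases p with
  | nil => exact absurd rfl hZ
  | @cons _ Y _ hadj p =>
    rw [Walk.cons_isPath_iff] at hp
    cases Y with
    | cut c hc => exact absurd hadj tree_not_adj_cut_cut
    | block B hB =>
      exact ⟨B, hB, tree_adj_cut_block.1 hadj, by simp, fun b hb z hz hbv hzv =>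
        reachable_avoid_of_tree_walk p hp.2 hb hz hbv hzv⟩

theorem exists_cut_of_walk_from_block {B : Set W} {hB : IsBlock H B} {Z : Node H}
    (p : (tree H).Walk (.block B hB) Z) (hZ : .block B hB ≠ Z) :
    ∃ (v : W) (hv : IsCutVertex H v), v ∈ B ∧ Node.cut v hv ∈ p.support := by
  cases p with
  | nil => exact absurd rfl hZ
  | @cons _ Y _ hadj p =>
    cases Y with
    | cut c hc => exact ⟨c, hc, tree_adj_cut_block.1 hadj.symm, by simp⟩
    | block B hB => exact absurd hadj tree_not_adj_block_block

/-- A separating cut vertex is met by every walk of the tree. Conversely, if `v` on a path did not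
separate, the blocks before and after it would coincide, and the path would visit one block twice.
-/
theorem between_cut_iff (hH : H.Connected) {v : W} {hv : IsCutVertex H v} {X Z : Node H} :
    Between X (.cut v hv) Z ↔ Separates v X Z := by
  classical
  constructor
  · rintro ⟨p, hp, hvp⟩ x hx z hz hxv hzv hxz
    have hXv : .cut v hv ≠ X := by
      rintro rfl
      exact hxv hx
    have hZv : .cut v hv ≠ Z := by
      rintro rfl
      exact hzv hz
    obtain ⟨q, r, hq, hr, rfl⟩ := hp.mem_support_iff_exists_append.1 hvp
    obtain ⟨B, hB, hvB, hBq, hBX⟩ := exists_block_of_path_from_cut q.reverse hq.reverse hXv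
    obtain ⟨B', hB', hvB', hBr, hBZ⟩ := exists_block_of_path_from_cut r hr hZv
    obtain ⟨b, hb, hbv⟩ := hB.exists_ne hH hxv.symm
    obtain ⟨b', hb', hbv'⟩ := hB'.exists_ne hH hxv.symm
    obtain rfl := hB.eq_of_reachable_avoid hH hB' hvB hvB' hb hb' hbv hbv'
      (((hBX b hb x hx hbv hxv).trans hxz).trans (hBZ b' hb' z hz hbv' hzv).symm)
    rw [Walk.support_reverse, List.mem_reverse] at hBq
    exact hp.ne_of_mem_support_of_append (by simp) hBq hBr rfl
  · intro h
    obtain ⟨p, hp⟩ := exists_path hH X Z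
    exact ⟨p, hp, h.mem_support hH p⟩

/-- A detour through a new vertex. -/
theorem isPath_detour {V : Type} {G : SimpleGraph V} {x c d z y : V} (q : G.Walk x c)
    (r : G.Walk c d) (s : G.Walk d z) (h : ((q.append r).append s).IsPath)
    (hy : y ∉ ((q.append r).append s).support) (hcd : c ≠ d) (hcy : G.Adj c y) (hyd : G.Adj y d) :
    ∃ p : G.Walk x z, p.IsPath ∧ y ∈ p.support := by
  refine ⟨q.append (.cons hcy (.cons hyd s)), ?_, ?_⟩
  · simp only [Walk.mem_support_append_iff, not_or] at hy
    have h' : (q.append (r.append s)).IsPath := by rwa [Walk.append_assoc]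
    rw [Walk.isPath_def, Walk.support_append, Walk.support_cons, List.tail_cons,
      Walk.support_cons, List.nodup_append, List.nodup_cons]
    refine ⟨h'.of_append_left.support_nodup, ⟨hy.2, h.of_append_right.support_nodup⟩, ?_⟩
    rintro u hu w hw rfl
    rcases List.mem_cons.1 hw with rfl | hw
    · exact hy.1.1 hu
    · by_cases huc : u = c
      · subst huc
        exact h'.of_append_right.ne_of_mem_support_of_append hcd r.start_mem_support hw rfl
      · exact h'.ne_of_mem_support_of_append huc hu
          ((Walk.mem_support_append_iff _ _).2 (Or.inr hw)) rfl
  · simp [Walk.mem_support_append_iff]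

/-- An inner block of a path has a cut node on either side. Conversely, every path visits both
separating cut nodes. Since `Between` asks for some path, a path that misses `B` may be rerouted
through it, and uniqueness of paths is not needed. -/
theorem between_block_iff (hH : H.Connected) {B : Set W} {hB : IsBlock H B} {X Z : Node H} :
    Between X (.block B hB) Z ↔ .block B hB = X ∨ .block B hB = Z ∨
      ∃ v ∈ B, ∃ w ∈ B, v ≠ w ∧ IsCutVertex H v ∧ IsCutVertex H w ∧ Separates v X Z ∧
        Separates w X Z := by
  classical
  constructor
  · rintro ⟨p, hp, hBp⟩
    by_cases hX : .block B hB = X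
    · exact Or.inl hX
    by_cases hZ : .block B hB = Z
    · exact Or.inr (Or.inl hZ)
    refine Or.inr (Or.inr ?_)
    obtain ⟨q, r, hq, hr, rfl⟩ := hp.mem_support_iff_exists_append.1 hBp
    obtain ⟨v, hv, hvB, hvq⟩ := exists_cut_of_walk_from_block q.reverse hX
    obtain ⟨w, hw, hwB, hwr⟩ := exists_cut_of_walk_from_block r hZ
    rw [Walk.support_reverse, List.mem_reverse] at hvq
    refine ⟨v, hvB, w, hwB, ?_, hv, hw,
      (between_cut_iff hH (hv := hv)).1 ⟨_, hp, (Walk.mem_support_append_iff _ _).2 (Or.inl hvq)⟩,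
      (between_cut_iff hH (hv := hw)).1 ⟨_, hp, (Walk.mem_support_append_iff _ _).2 (Or.inr hwr)⟩⟩
    rintro rfl
    exact hp.ne_of_mem_support_of_append (by simp) hvq hwr rfl
  · rintro (rfl | rfl | ⟨v, hvB, w, hwB, hvw, hv, hw, hvs, hws⟩)
    · obtain ⟨p, hp⟩ := exists_path hH (.block B hB) Z
      exact ⟨p, hp, p.start_mem_support⟩
    · obtain ⟨p, hp⟩ := exists_path hH X (.block B hB)
      exact ⟨p, hp, p.end_mem_support⟩
    · obtain ⟨p, hp⟩ := exists_path hH X Z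
      by_cases hBp : Node.block B hB ∈ p.support
      · exact ⟨p, hp, hBp⟩
      have hvp := hvs.mem_support hH (hv := hv) p
      have hwp := hws.mem_support hH (hv := hw) p
      have hne : Node.cut v hv ≠ Node.cut w hw := by simpa using hvw
      have hvB := (tree_adj_cut_block (hv := hv) (hB := hB)).2 hvB
      have hwB := (tree_adj_cut_block (hv := hw) (hB := hB)).2 hwB
      obtain ⟨q, r, -, -, rfl⟩ := hp.mem_support_iff_exists_append.1 hvp
      rcases (Walk.mem_support_append_iff _ _).1 hwp with hwq | hwr
      · obtain ⟨q₁, q₂, rfl⟩ := Walk.mem_support_iff_exists_append.1 hwq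
        exact isPath_detour q₁ q₂ r hp hBp hne.symm hwB hvB.symm
      · obtain ⟨r₁, r₂, rfl⟩ := Walk.mem_support_iff_exists_append.1 hwr
        rw [Walk.append_assoc] at hp hBp
        exact isPath_detour q r₁ r₂ hp hBp hne hvB hwB.symm

end Tree

end BCTree
/-! ### The relations of the BC-trees in terms of adjacency and avoiding reachability -/

namespace BCTree

open SimpleGraph DynFO

section Names

variable {V : Type} (E : V → V → Prop) (R : V → V → V → Prop)

/-- `x` and `y` are connected. Here `E` is adjacency, and `R w x y` says that `x` and `y` are
connected without using `w`. -/
def Conn (x y : V) : Prop := x = y ∨ ∃ z, E x z ∧ R x z y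

/-- `a` and `b` are connected, and no single vertex separates them. -/
def ConnNonSep (a b : V) : Prop := Conn E R a b ∧ ∀ v, v ≠ a → v ≠ b → R v a b

/-- `(a, b)` names a block. -/
def BlockName (a b : V) : Prop := (a ≠ b ∧ ConnNonSep E R a b) ∨ (a = b ∧ ∀ u, ¬ E a u)

/-- `(a, b)` names a cut vertex. -/
def CutName (a b : V) : Prop :=
  a = b ∧ ∃ x y, x ≠ a ∧ y ≠ a ∧ Conn E R a x ∧ Conn E R a y ∧ ¬ R a x y

/-- `(a, b)` names a node. -/
def NodeName (a b : V) : Prop := BlockName E R a b ∨ CutName E R a b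

/-- `c` is a vertex of the node with the name `(a, b)`. -/
def Member (a b c : V) : Prop :=
  (a = b ∧ c = a) ∨ (a ≠ b ∧ ConnNonSep E R a c ∧ ConnNonSep E R b c)

/-- `(a, b)` and `(c, d)` name nodes with the same vertices. -/
def SameMembers (a b c d : V) : Prop := ∀ v, Member E R a b v ↔ Member E R c d v

/-- `v` separates the node with the name `(a, b)` from the node with the name `(c, d)`. -/
def SeparatesNames (v a b c d : V) : Prop :=
  ∀ x z, Member E R a b x → Member E R c d z → x ≠ v → z ≠ v → ¬ R v x z

/-- Two vertices of the node with the name `(c, d)` are cut vertices that separate the nodes with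
the names `(a, b)` and `(e, f)`. -/
def TwiceSeparated (a b c d e f : V) : Prop :=
  ∃ v w, Member E R c d v ∧ Member E R c d w ∧ v ≠ w ∧ CutName E R v v ∧ CutName E R w w ∧
    SeparatesNames E R v a b e f ∧ SeparatesNames E R w a b e f

/-- The node with the name `(c, d)` is between those with the names `(a, b)` and `(e, f)`. -/
def BetweenNames (a b c d e f : V) : Prop :=
  NodeName E R a b ∧ NodeName E R e f ∧ Conn E R a c ∧ Conn E R a e ∧
    ((CutName E R c d ∧ SeparatesNames E R c a b e f) ∨
      (BlockName E R c d ∧ (SameMembers E R c d a b ∨ SameMembers E R c d e f ∨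
        TwiceSeparated E R a b c d e f)))

/-- The relations of the BC-trees, expressed by `E` and `R`. -/
def Rel.express : (r : Rel) → (Fin r.arity → V) → Prop
  | .blockNode => fun x : Fin 2 → V => BlockName E R (x 0) (x 1)
  | .cutNode => fun x : Fin 2 → V => CutName E R (x 0) (x 1)
  | .sameNode => fun x : Fin 4 → V =>
      NodeName E R (x 0) (x 1) ∧ NodeName E R (x 2) (x 3) ∧
        SameMembers E R (x 0) (x 1) (x 2) (x 3)
  | .vertexOf => fun x : Fin 3 → V => NodeName E R (x 0) (x 1) ∧ Member E R (x 0) (x 1) (x 2)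
  | .treeEdge => fun x : Fin 4 → V =>
      (CutName E R (x 0) (x 1) ∧ BlockName E R (x 2) (x 3) ∧ Member E R (x 2) (x 3) (x 0)) ∨
      (BlockName E R (x 0) (x 1) ∧ CutName E R (x 2) (x 3) ∧ Member E R (x 0) (x 1) (x 2))
  | .between => fun x : Fin 6 → V =>
      BetweenNames E R (x 0) (x 1) (x 2) (x 3) (x 4) (x 5)

end Names

/-! ### Correctness of the expressions, component by component -/

section Components

variable {V : Type} {G : SimpleGraph V}

/-- Reachability in `G` without a vertex. -/
abbrev reach (G : SimpleGraph V) (w x y : V) : Prop := (avoid G w).Reachable x y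

/-- A path never returns to its start `x`, so after its first edge it avoids `x`. Hence no separate
forest for the whole graph is needed. -/
theorem conn_iff {x y : V} : Conn G.Adj (reach G) x y ↔ G.Reachable x y := by
  classical
  constructor
  · rintro (rfl | ⟨z, hz, h⟩)
    · rfl
    · exact hz.reachable.trans (h.mono (avoid_le G x))
  · rintro ⟨p⟩
    have hp := p.bypass_isPath
    generalize p.bypass = q at hp
    cases q with
    | nil => exact Or.inl rfl
    | cons hadj q =>
      rw [Walk.cons_isPath_iff] at hp
      exact Or.inr ⟨_, hadj, reachable_avoid_of_walk q hp.2⟩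

variable {C : G.ConnectedComponent}

theorem mem_of_reachable {x y : V} (hx : x ∈ C) (h : G.Reachable x y) : y ∈ C :=
  (ConnectedComponent.sound h).symm.trans hx

theorem reachable_avoid_coe_iff {w x y : C} :
    (avoid C.toSimpleGraph w).Reachable x y ↔ reach G w x y := by
  constructor
  · intro h
    exact h.map (G' := avoid G w) ⟨Subtype.val, fun {a b}
      (hab : (avoid C.toSimpleGraph w).Adj a b) =>
        ⟨hab.1, fun h => hab.2.1 (Subtype.ext h), fun h => hab.2.2 (Subtype.ext h)⟩⟩
  · obtain ⟨x, hx⟩ := x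
    obtain ⟨y, hy⟩ := y
    rintro ⟨p⟩
    change (avoid G w).Walk x y at p
    induction p with
    | nil => rfl
    | @cons u v _ hadj p ih =>
      have hv : v ∈ C := mem_of_reachable hx hadj.1.reachable
      refine Reachable.trans (Adj.reachable (v := ⟨v, hv⟩) ?_) (ih hv hy)
      exact ⟨hadj.1, fun h => hadj.2.1 (congrArg Subtype.val h),
        fun h => hadj.2.2 (congrArg Subtype.val h)⟩

/-- A vertex outside of the component separates nothing in it. Connectivity is a separate
requirement in `ConnNonSep`, since on a domain without third vertices the other condition is
vacuous. -/
theorem nonSep_coe_iff {a b : C} :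
    NonSep C.toSimpleGraph a b ↔ ConnNonSep G.Adj (reach G) a b := by
  rw [ConnNonSep, conn_iff]
  constructor
  · intro h
    refine ⟨C.reachable_of_mem_supp a.2 b.2, fun v hva hvb => ?_⟩
    by_cases hv : v ∈ C
    · exact reachable_avoid_coe_iff.1 (h ⟨v, hv⟩ (fun e => hva (congrArg Subtype.val e))
        (fun e => hvb (congrArg Subtype.val e)))
    · exact (C.connected_toSimpleGraph.preconnected a b).map (G' := avoid G v) ⟨Subtype.val,
        fun {x y} hxy => ⟨hxy, fun h => hv (h ▸ x.2), fun h => hv (h ▸ y.2)⟩⟩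
  · exact fun h v hva hvb => reachable_avoid_coe_iff.2
      (h.2 v (fun e => hva (Subtype.ext e)) (fun e => hvb (Subtype.ext e)))

theorem ConnNonSep.mem {a b : V} (h : ConnNonSep G.Adj (reach G) a b) (ha : a ∈ C) : b ∈ C :=
  mem_of_reachable ha (conn_iff.1 h.1)

theorem isCutVertex_coe_iff {v : C} :
    IsCutVertex C.toSimpleGraph v ↔ CutName G.Adj (reach G) v v := by
  rw [isCutVertex_iff C.connected_toSimpleGraph, CutName, and_iff_right rfl]
  simp only [conn_iff]
  constructor
  · rintro ⟨x, y, hx, hy, h⟩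
    exact ⟨x, y, fun e => hx (Subtype.ext e), fun e => hy (Subtype.ext e),
      C.reachable_of_mem_supp v.2 x.2, C.reachable_of_mem_supp v.2 y.2,
      fun h' => h (reachable_avoid_coe_iff.2 h')⟩
  · rintro ⟨x, y, hx, hy, hvx, hvy, h⟩
    exact ⟨⟨x, mem_of_reachable v.2 hvx⟩, ⟨y, mem_of_reachable v.2 hvy⟩,
      fun e => hx (congrArg Subtype.val e), fun e => hy (congrArg Subtype.val e),
      fun h' => h (reachable_avoid_coe_iff.1 h')⟩

theorem CNode.mem_vertices {X : CNode C} {x : C} : (x : V) ∈ X.vertices ↔ x ∈ X.verts :=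
  Subtype.val_injective.mem_set_image

theorem CNode.mem_component {X : CNode C} {x : V} (hx : x ∈ X.vertices) : x ∈ C := by
  obtain ⟨y, -, rfl⟩ := hx
  exact y.2

theorem component_eq {C' : G.ConnectedComponent} {v : V} (h : v ∈ C) (h' : v ∈ C') : C = C' :=
  h.symm.trans h'

/-- A block and a cut node cannot have the same vertices: a graph with a cut vertex has no block of
one vertex. -/
theorem Node.eq_of_verts {W : Type} {H : SimpleGraph W} (hH : H.Connected) {X Y : Node H}
    (h : X.verts = Y.verts) : X = Y := by
  have key : ∀ {B : Set W} {v : W} (_ : IsBlock H B) (_ : IsCutVertex H v), B ≠ {v} := by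
    rintro B v hB hv rfl
    obtain ⟨w, hw, hwv⟩ := hB.exists_ne hH hv.exists_ne.choose_spec
    exact hwv hw
  cases X with
  | block B hB =>
    cases Y with
    | block B' hB' =>
      obtain rfl : B = B' := h
      rfl
    | cut v hv => exact absurd h (key hB hv)
  | cut v hv =>
    cases Y with
    | block B hB => exact absurd h.symm (key hB hv)
    | cut w hw =>
      obtain rfl : v = w := Set.singleton_injective h
      rfl

theorem Names.mem_iff {a b : V} {X : CNode C} (h : Names a b X) {c : V} :
    c ∈ X.vertices ↔ Member G.Adj (reach G) a b c := by
  obtain ⟨ha, hb, hab⟩ := h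
  by_cases he : a = b
  · rw [hab he]
    simp [Member, he]
  · rw [Member]
    simp only [he, false_and, false_or, ne_eq, not_false_eq_true, true_and]
    cases X with
    | cut v hv =>
      obtain ⟨a', ha', rfl⟩ := ha
      obtain ⟨b', hb', rfl⟩ := hb
      exact absurd (congrArg Subtype.val ((show a' = v from ha').trans
        (show b' = v from hb').symm)) he
    | block B hB =>
      obtain ⟨a, ha, rfl⟩ := ha
      obtain ⟨b, hb, rfl⟩ := hb
      have hB' := hB.eq_blockSet C.connected_toSimpleGraph ha hb fun e => he (congrArg _ e)
      constructor
      · rintro ⟨c, hc, rfl⟩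
        rw [← nonSep_coe_iff, ← nonSep_coe_iff]
        exact ⟨hB.nonSep ha hc, hB.nonSep hb hc⟩
      · intro hc
        have hcC : c ∈ C := hc.1.mem a.2
        refine ⟨⟨c, hcC⟩, ?_, rfl⟩
        change _ ∈ B
        rw [hB']
        exact ⟨nonSep_coe_iff.2 hc.1, nonSep_coe_iff.2 hc.2⟩

theorem Names.eq_of_sameMembers {a b c d : V} {X Y : CNode C} (hX : Names a b X)
    (hY : Names c d Y) (h : SameMembers G.Adj (reach G) a b c d) : X = Y := by
  refine Node.eq_of_verts C.connected_toSimpleGraph ?_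
  ext x
  rw [← CNode.mem_vertices, ← CNode.mem_vertices, hX.mem_iff, hY.mem_iff]
  exact h x

theorem Names.sameMembers {a b c d : V} {X : CNode C} (hX : Names a b X) (hX' : Names c d X) :
    SameMembers G.Adj (reach G) a b c d := fun _ => hX.mem_iff.symm.trans hX'.mem_iff

theorem Names.unique {a b : V} {X Y : CNode C} (hX : Names a b X) (hY : Names a b Y) : X = Y :=
  hX.eq_of_sameMembers hY fun _ => .rfl

theorem blockName_iff {a b : V} : BlockName G.Adj (reach G) a b ↔
    ∃ (C : G.ConnectedComponent) (X : CNode C), X.IsBlockNode ∧ Names a b X := by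
  constructor
  · intro h
    have ha : a ∈ G.connectedComponentMk a := rfl
    rcases h with ⟨hne, h⟩ | ⟨rfl, h⟩
    · have hb := h.mem ha
      refine ⟨G.connectedComponentMk a, .block _ (isBlock_blockSet
        (ConnectedComponent.connected_toSimpleGraph _) (a := ⟨a, ha⟩) (b := ⟨b, hb⟩)
        (fun e => hne (congrArg Subtype.val e)) (nonSep_coe_iff.2 h)), trivial,
        ⟨⟨a, ha⟩, ?_, rfl⟩, ⟨⟨b, hb⟩, ?_, rfl⟩, fun e => absurd e hne⟩
      · exact ⟨.refl _, (nonSep_coe_iff.2 h).symm⟩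
      · exact ⟨nonSep_coe_iff.2 h, .refl _⟩
    · have hall : ∀ u : G.connectedComponentMk a, u = ⟨a, ha⟩ := by
        by_contra! hn
        obtain ⟨u, hu⟩ := hn
        obtain ⟨w, hw⟩ := exists_adj_of_ne
          (G.connectedComponentMk a).connected_toSimpleGraph hu.symm
        exact h w hw
      refine ⟨G.connectedComponentMk a, .block _ (isBlock_singleton hall), trivial,
        ⟨⟨a, ha⟩, rfl, rfl⟩, ⟨⟨a, ha⟩, rfl, rfl⟩, fun _ => ?_⟩
      exact Set.image_singleton
  · rintro ⟨C, X, hX, hn⟩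
    cases X with
    | cut v hv => exact hX.elim
    | block B hB =>
      obtain ⟨⟨a, ha, rfl⟩, ⟨b, hb, rfl⟩, hab⟩ := hn
      by_cases he : (a : V) = b
      · refine Or.inr ⟨he, fun u hu => ?_⟩
        have huC : u ∈ C := mem_of_reachable a.2 hu.reachable
        obtain ⟨w, hw, hwa⟩ := hB.exists_ne C.connected_toSimpleGraph (v := a) (u := ⟨u, huC⟩)
          fun e => hu.ne (congrArg Subtype.val e)
        have : (w : V) ∈ CNode.vertices (.block B hB) := ⟨w, hw, rfl⟩
        rw [hab he] at this
        exact hwa (Subtype.ext this)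
      · exact Or.inl ⟨he, nonSep_coe_iff.1 (hB.nonSep ha hb)⟩

theorem cutName_iff {a b : V} : CutName G.Adj (reach G) a b ↔
    ∃ (C : G.ConnectedComponent) (X : CNode C), X.IsCutNode ∧ Names a b X := by
  constructor
  · intro h
    obtain rfl := h.1
    refine ⟨G.connectedComponentMk a, .cut ⟨a, rfl⟩ (isCutVertex_coe_iff.2 h), trivial,
        ⟨⟨a, rfl⟩, rfl, rfl⟩, ⟨⟨a, rfl⟩, rfl, rfl⟩, fun _ => ?_⟩
    exact Set.image_singleton
  · rintro ⟨C, X, hX, ⟨a, ha, rfl⟩, ⟨b, hb, rfl⟩, -⟩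
    cases X with
    | block B hB => exact hX.elim
    | cut v hv =>
      obtain rfl : a = v := ha
      obtain rfl : b = a := hb
      exact isCutVertex_coe_iff.1 hv

theorem nodeName_iff {a b : V} : NodeName G.Adj (reach G) a b ↔
    ∃ (C : G.ConnectedComponent) (X : CNode C), Names a b X := by
  rw [NodeName, blockName_iff, cutName_iff]
  constructor
  · rintro (⟨C, X, -, h⟩ | ⟨C, X, -, h⟩) <;> exact ⟨C, X, h⟩
  · rintro ⟨C, X, h⟩
    cases X with
    | block B hB => exact Or.inl ⟨C, .block B hB, trivial, h⟩
    | cut v hv => exact Or.inr ⟨C, .cut v hv, trivial, h⟩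

theorem separates_iff {v : C} {a b c d : V} {X Z : CNode C} (hX : Names a b X)
    (hZ : Names c d Z) : Separates v X Z ↔ SeparatesNames G.Adj (reach G) v a b c d := by
  constructor
  · intro h x z hx hz hxv hzv hr
    rw [← hX.mem_iff] at hx
    rw [← hZ.mem_iff] at hz
    obtain ⟨x, hx, rfl⟩ := hx
    obtain ⟨z, hz, rfl⟩ := hz
    exact h x hx z hz (fun e => hxv (congrArg _ e)) (fun e => hzv (congrArg _ e))
      (reachable_avoid_coe_iff.2 hr)
  · intro h x hx z hz hxv hzv hr
    exact h x z (hX.mem_iff.1 (CNode.mem_vertices.2 hx)) (hZ.mem_iff.1 (CNode.mem_vertices.2 hz))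
      (fun e => hxv (Subtype.ext e)) (fun e => hzv (Subtype.ext e)) (reachable_avoid_coe_iff.1 hr)

theorem between_names_iff {a b c d e f : V} {X Y Z : CNode C} (hX : Names a b X)
    (hY : Names c d Y) (hZ : Names e f Z) : Between X Y Z ↔
      (CutName G.Adj (reach G) c d ∧ SeparatesNames G.Adj (reach G) c a b e f) ∨
        (BlockName G.Adj (reach G) c d ∧ (SameMembers G.Adj (reach G) c d a b ∨
          SameMembers G.Adj (reach G) c d e f ∨ TwiceSeparated G.Adj (reach G) a b c d e f)) := by
  have hC := C.connected_toSimpleGraph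
  have hcC : c ∈ C := hY.1.elim fun y hy => hy.2 ▸ y.2
  have hcut : CutName G.Adj (reach G) c d ↔ Y.IsCutNode := by
    rw [cutName_iff]
    refine ⟨?_, fun h => ⟨C, Y, h, hY⟩⟩
    rintro ⟨C', Y', h, hY'⟩
    obtain rfl := component_eq hcC (CNode.mem_component hY'.1)
    rwa [hY.unique hY']
  have hblock : BlockName G.Adj (reach G) c d ↔ Y.IsBlockNode := by
    rw [blockName_iff]
    refine ⟨?_, fun h => ⟨C, Y, h, hY⟩⟩
    rintro ⟨C', Y', h, hY'⟩
    obtain rfl := component_eq hcC (CNode.mem_component hY'.1)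
    rwa [hY.unique hY']
  rw [hcut, hblock]
  cases Y with
  | cut v hv =>
    obtain ⟨y, hy, rfl⟩ := hY.1
    obtain rfl : y = v := hy
    simp only [Node.IsCutNode, Node.IsBlockNode, true_and, false_and, or_false]
    rw [between_cut_iff hC, separates_iff hX hZ]
  | block B hB =>
    simp only [Node.IsCutNode, Node.IsBlockNode, true_and, false_and, false_or]
    rw [between_block_iff hC]
    refine or_congr ⟨?_, hY.eq_of_sameMembers hX⟩ (or_congr ⟨?_, hY.eq_of_sameMembers hZ⟩ ?_)
    · rintro rfl
      exact hY.sameMembers hX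
    · rintro rfl
      exact hY.sameMembers hZ
    · constructor
      · rintro ⟨v, hv, w, hw, hvw, hvc, hwc, hvs, hws⟩
        exact ⟨v, w, hY.mem_iff.1 (CNode.mem_vertices.2 hv), hY.mem_iff.1 (CNode.mem_vertices.2 hw),
          fun e => hvw (Subtype.ext e), isCutVertex_coe_iff.1 hvc, isCutVertex_coe_iff.1 hwc,
          (separates_iff hX hZ).1 hvs, (separates_iff hX hZ).1 hws⟩
      · rintro ⟨v, w, hv, hw, hvw, hvc, hwc, hvs, hws⟩
        obtain ⟨v, hvB, rfl⟩ := hY.mem_iff.2 hv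
        obtain ⟨w, hwB, rfl⟩ := hY.mem_iff.2 hw
        exact ⟨v, hvB, w, hwB, fun e => hvw (congrArg _ e), isCutVertex_coe_iff.2 hvc,
          isCutVertex_coe_iff.2 hwc, (separates_iff hX hZ).2 hvs, (separates_iff hX hZ).2 hws⟩

/-- The two connectivity conditions force the three named nodes into a common component. -/
theorem betweenNames_iff {a b c d e f : V} : BetweenNames G.Adj (reach G) a b c d e f ↔
    ∃ (C : G.ConnectedComponent) (X Y Z : CNode C),
      Names a b X ∧ Names c d Y ∧ Names e f Z ∧ Between X Y Z := by
  constructor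
  · rintro ⟨hab, hef, hac, hae, h⟩
    have hcd : NodeName G.Adj (reach G) c d := h.elim (fun h => Or.inr h.1) (fun h => Or.inl h.1)
    obtain ⟨C, X, hX⟩ := nodeName_iff.1 hab
    obtain ⟨C', Y, hY⟩ := nodeName_iff.1 hcd
    obtain ⟨C'', Z, hZ⟩ := nodeName_iff.1 hef
    obtain rfl := component_eq (mem_of_reachable (CNode.mem_component hX.1) (conn_iff.1 hac))
      (CNode.mem_component hY.1)
    obtain rfl := component_eq (mem_of_reachable (CNode.mem_component hX.1) (conn_iff.1 hae))
      (CNode.mem_component hZ.1)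
    exact ⟨C, X, Y, Z, hX, hY, hZ, (between_names_iff hX hY hZ).2 h⟩
  · rintro ⟨C, X, Y, Z, hX, hY, hZ, h⟩
    have hr : ∀ {x y : V}, x ∈ C → y ∈ C → Conn G.Adj (reach G) x y := fun hx hy =>
      conn_iff.2 (C.reachable_of_mem_supp hx hy)
    exact ⟨nodeName_iff.2 ⟨C, X, hX⟩, nodeName_iff.2 ⟨C, Z, hZ⟩,
      hr (CNode.mem_component hX.1) (CNode.mem_component hY.1),
      hr (CNode.mem_component hX.1) (CNode.mem_component hZ.1), (between_names_iff hX hY hZ).1 h⟩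

theorem exists_tree_adj_iff {a b c d : V} :
    (CutName G.Adj (reach G) a b ∧ BlockName G.Adj (reach G) c d ∧
      Member G.Adj (reach G) c d a) ↔ ∃ (C : G.ConnectedComponent) (X Y : CNode C),
        X.IsCutNode ∧ Names a b X ∧ Names c d Y ∧ (tree C.toSimpleGraph).Adj X Y := by
  constructor
  · rintro ⟨hab, hcd, h⟩
    obtain ⟨C, X, hXc, hX⟩ := cutName_iff.1 hab
    obtain ⟨C', Y, hYb, hY⟩ := blockName_iff.1 hcd
    rw [← hY.mem_iff] at h
    obtain rfl := component_eq (CNode.mem_component hX.1) (CNode.mem_component h)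
    refine ⟨C, X, Y, hXc, hX, hY, ?_⟩
    cases X with
    | block B hB => exact hXc.elim
    | cut v hv =>
      cases Y with
      | cut w hw => exact hYb.elim
      | block B hB =>
        obtain ⟨x, hx, rfl⟩ := hX.1
        obtain rfl : x = v := hx
        exact tree_adj_cut_block.2 (CNode.mem_vertices.1 h)
  · rintro ⟨C, X, Y, hXc, hX, hY, hadj⟩
    cases X with
    | block B hB => exact hXc.elim
    | cut v hv =>
      cases Y with
      | cut w hw => exact absurd hadj tree_not_adj_cut_cut
      | block B hB =>
        refine ⟨cutName_iff.2 ⟨C, .cut v hv, trivial, hX⟩,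
          blockName_iff.2 ⟨C, .block B hB, trivial, hY⟩, ?_⟩
        rw [← hY.mem_iff]
        obtain ⟨x, hx, rfl⟩ := hX.1
        obtain rfl : x = v := hx
        exact CNode.mem_vertices.2 (tree_adj_cut_block.1 hadj)

theorem treeEdge_iff {a b c d : V} :
    (CutName G.Adj (reach G) a b ∧ BlockName G.Adj (reach G) c d ∧
      Member G.Adj (reach G) c d a) ∨ (BlockName G.Adj (reach G) a b ∧
        CutName G.Adj (reach G) c d ∧ Member G.Adj (reach G) a b c) ↔
      ∃ (C : G.ConnectedComponent) (X Y : CNode C),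
        Names a b X ∧ Names c d Y ∧ (tree C.toSimpleGraph).Adj X Y := by
  rw [and_left_comm (a := BlockName G.Adj (reach G) a b), exists_tree_adj_iff, exists_tree_adj_iff]
  constructor
  · rintro (⟨C, X, Y, -, hX, hY, h⟩ | ⟨C, Y, X, -, hY, hX, h⟩)
    · exact ⟨C, X, Y, hX, hY, h⟩
    · exact ⟨C, X, Y, hX, hY, h.symm⟩
  · rintro ⟨C, X, Y, hX, hY, h⟩
    cases X with
    | cut v hv => exact Or.inl ⟨C, .cut v hv, _, trivial, hX, hY, h⟩
    | block B hB =>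
      cases Y with
      | cut v hv => exact Or.inr ⟨C, .cut v hv, _, trivial, hY, hX, h.symm⟩
      | block B' hB' => exact absurd h tree_not_adj_block_block

theorem Rel.express_iff (r : Rel) (x : Fin r.arity → V) :
    r.express G.Adj (reach G) x ↔ x ∈ r.eval G := by
  cases r with
  | blockNode => exact blockName_iff
  | cutNode => exact cutName_iff
  | sameNode =>
    refine Iff.trans ?_ (Iff.rfl : (∃ (C : G.ConnectedComponent) (X : CNode C), _) ↔ _)
    constructor
    · rintro ⟨hab, hcd, h⟩
      obtain ⟨C, X, hX⟩ := nodeName_iff.1 hab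
      obtain ⟨C', Y, hY⟩ := nodeName_iff.1 hcd
      -- The vertex `a` belongs to both nodes, so their components coincide.
      obtain rfl := component_eq (CNode.mem_component hX.1)
        (CNode.mem_component (hY.mem_iff.2 ((h _).1 (hX.mem_iff.1 hX.1))))
      obtain rfl := hX.eq_of_sameMembers hY h
      exact ⟨C, X, hX, hY⟩
    · rintro ⟨C, X, hX, hX'⟩
      exact ⟨nodeName_iff.2 ⟨C, X, hX⟩, nodeName_iff.2 ⟨C, X, hX'⟩, hX.sameMembers hX'⟩
  | vertexOf =>
    refine Iff.trans ?_ (Iff.rfl : (∃ (C : G.ConnectedComponent) (X : CNode C), _) ↔ _)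
    constructor
    · rintro ⟨hab, h⟩
      obtain ⟨C, X, hX⟩ := nodeName_iff.1 hab
      exact ⟨C, X, hX, hX.mem_iff.2 h⟩
    · rintro ⟨C, X, hX, h⟩
      exact ⟨nodeName_iff.2 ⟨C, X, hX⟩, hX.mem_iff.1 h⟩
  | treeEdge => exact treeEdge_iff
  | between => exact betweenNames_iff

end Components

end BCTree
/-! ### First-order definability of the update rules -/

namespace DynFO

open BCTree

section Rules

variable {σ τ : FirstOrder.Language.{0, 0}} [σ.IsRelational] [τ.IsRelational]

namespace FODefinable

variable {α : Type}

theorem input₂ (R : σ.Relations 2) (i j : α) :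
    FODefinable (σ := σ) (τ := τ) fun _ I _ x => ![x i, x j] ∈ I 2 R :=
  congr (fun _ I _ x => .of_eq (congrArg (· ∈ I _ R) (FinVec.map_eq x ![i, j]).symm))
    (input R ![i, j])

theorem aux₂ (R : τ.Relations 2) (i j : α) :
    FODefinable (σ := σ) (τ := τ) fun _ _ A x => ![x i, x j] ∈ A 2 R :=
  congr (fun _ _ A x => .of_eq (congrArg (· ∈ A _ R) (FinVec.map_eq x ![i, j]).symm))
    (aux R ![i, j])

theorem aux₄ (R : τ.Relations 4) (i j k l : α) :
    FODefinable (σ := σ) (τ := τ) fun _ _ A x => ![x i, x j, x k, x l] ∈ A 4 R :=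
  congr (fun _ _ A x => .of_eq (congrArg (· ∈ A _ R) (FinVec.map_eq x ![i, j, k, l]).symm))
    (aux R ![i, j, k, l])

theorem aux₅ (R : τ.Relations 5) (i j k l m : α) :
    FODefinable (σ := σ) (τ := τ) fun _ _ A x => ![x i, x j, x k, x l, x m] ∈ A 5 R :=
  congr (fun _ _ A x => .of_eq (congrArg (· ∈ A _ R) (FinVec.map_eq x ![i, j, k, l, m]).symm))
    (aux R ![i, j, k, l, m])

end FODefinable

/-- A binary relation, given uniformly for all domains and interpretations, that is first-order
definable. -/
def FODefinable₂ (E : (D : Type) → Interp σ D → Interp τ D → D → D → Prop) : Prop :=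
  ∀ {α : Type} (i j : α), FODefinable fun D I A x => E D I A (x i) (x j)

/-- The version of `FODefinable₂` for ternary relations. -/
def FODefinable₃ (R : (D : Type) → Interp σ D → Interp τ D → D → D → D → Prop) : Prop :=
  ∀ {α : Type} (i j k : α), FODefinable fun D I A x => R D I A (x i) (x j) (x k)

/-- The version of `FODefinable₂` for relations of arity four. -/
def FODefinable₄ (O : (D : Type) → Interp σ D → Interp τ D → D → D → D → D → Prop) : Prop :=
  ∀ {α : Type} (i j k l : α), FODefinable fun D I A x => O D I A (x i) (x j) (x k) (x l)

/-- The version of `FODefinable₂` for relations of arity five. -/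
def FODefinable₅ (K : (D : Type) → Interp σ D → Interp τ D → D → D → D → D → D → Prop) : Prop :=
  ∀ {α : Type} (i j k l m : α),
    FODefinable fun D I A x => K D I A (x i) (x j) (x k) (x l) (x m)

namespace FODefinable

/-! ### Definability of the forest updates -/

section Forests

variable {E E' : (D : Type) → Interp σ D → Interp τ D → D → D → Prop}
  {O : (D : Type) → Interp σ D → Interp τ D → D → D → D → D → Prop}
  {K : (D : Type) → Interp σ D → Interp τ D → D → D → D → D → D → Prop}

theorem newOrder (hE : FODefinable₂ E) (hE' : FODefinable₂ E') (hO : FODefinable₄ O) :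
    FODefinable₄ fun D I A => DynFO.newOrder (E D I A) (E' D I A) (O D I A) := fun i j k l =>
  ((hE' i j).and (hE i j).not).not.and (((hE' k l).and (hE k l).not).or (hO i j k l))

theorem reflLink (hK : FODefinable₅ K) : FODefinable₅ fun D I A => DynFO.reflLink (K D I A) :=
  fun w u v x y => (eq x y).or (hK w u v x y)

theorem oldLink (hE : FODefinable₂ E) (hE' : FODefinable₂ E') (hK : FODefinable₅ K) :
    FODefinable₅ fun D I A => DynFO.oldLink (E D I A) (E' D I A) (K D I A) := fun w u v x y =>
  (reflLink hK w u v x y).and (all (all (((hE _ _).and (hE' _ _).not).imp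
    (reflLink hK (some (some w)) (some none) none (some (some x)) (some (some y))))))

theorem crossing (hE : FODefinable₂ E) (hE' : FODefinable₂ E') (hK : FODefinable₅ K) :
    FODefinable₃ fun D I A => Crossing (E D I A) (E' D I A) (K D I A) := fun w c d =>
  (hE' c d).and ((eq c w).not.and ((eq d w).not.and (oldLink hE hE' hK w w w c d).not))

theorem repair (hE : FODefinable₂ E) (hE' : FODefinable₂ E') (hO : FODefinable₄ O)
    (hK : FODefinable₅ K) :
    FODefinable₃ fun D I A => Repair (E D I A) (E' D I A) (O D I A) (K D I A) := fun w c d =>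
  (crossing hE hE' hK w c d).and (all (all ((crossing hE hE' hK (some (some w)) _ _).imp
    (newOrder hE hE' hO (some none) none (some (some c)) (some (some d))).not)))

theorem newLink (hE : FODefinable₂ E) (hE' : FODefinable₂ E') (hO : FODefinable₄ O)
    (hK : FODefinable₅ K) :
    FODefinable₅ fun D I A => DynFO.newLink (E D I A) (E' D I A) (O D I A) (K D I A) :=
  fun w u v x y => (oldLink hE hE' hK w u v x y).or (ex (ex
    ((repair hE hE' hO hK (some (some w)) (some none) none).and
    ((((eq (some (some u)) (some none)).and (eq (some (some v)) none)).or
      ((eq (some (some u)) none).and (eq (some (some v)) (some none)))).not.and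
    ((oldLink hE hE' hK (some (some w)) (some (some u)) (some (some v)) (some (some x))
      (some none)).and
    (oldLink hE hE' hK (some (some w)) (some (some u)) (some (some v)) none
      (some (some y))))))))

end Forests

/-! ### Definability of the BC-tree relations -/

section Names

variable {E : (D : Type) → Interp σ D → Interp τ D → D → D → Prop}
  {R : (D : Type) → Interp σ D → Interp τ D → D → D → D → Prop}

theorem conn (hE : FODefinable₂ E) (hR : FODefinable₃ R) :
    FODefinable₂ fun D I A => Conn (E D I A) (R D I A) := fun x y =>
  (eq x y).or (ex ((hE (some x) none).and (hR (some x) none (some y))))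

theorem connNonSep (hE : FODefinable₂ E) (hR : FODefinable₃ R) :
    FODefinable₂ fun D I A => ConnNonSep (E D I A) (R D I A) := fun a b =>
  (conn hE hR a b).and (all ((eq none (some a)).not.imp ((eq none (some b)).not.imp
    (hR none (some a) (some b)))))

theorem blockName (hE : FODefinable₂ E) (hR : FODefinable₃ R) :
    FODefinable₂ fun D I A => BlockName (E D I A) (R D I A) := fun a b =>
  ((eq a b).not.and (connNonSep hE hR a b)).or
    ((eq a b).and (all (hE (some a) none).not))

theorem cutName (hE : FODefinable₂ E) (hR : FODefinable₃ R) :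
    FODefinable₂ fun D I A => CutName (E D I A) (R D I A) := fun a b =>
  (eq a b).and (ex (ex ((eq (some none) (some (some a))).not.and
    ((eq none (some (some a))).not.and
    ((conn hE hR (some (some a)) (some none)).and ((conn hE hR (some (some a)) none).and
    (hR (some (some a)) (some none) none).not))))))

theorem nodeName (hE : FODefinable₂ E) (hR : FODefinable₃ R) :
    FODefinable₂ fun D I A => NodeName (E D I A) (R D I A) := fun a b =>
  (blockName hE hR a b).or (cutName hE hR a b)

theorem member (hE : FODefinable₂ E) (hR : FODefinable₃ R) :
    FODefinable₃ fun D I A => Member (E D I A) (R D I A) := fun a b c =>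
  ((eq a b).and (eq c a)).or
    ((eq a b).not.and ((connNonSep hE hR a c).and (connNonSep hE hR b c)))

theorem sameMembers (hE : FODefinable₂ E) (hR : FODefinable₃ R) :
    FODefinable₄ fun D I A => SameMembers (E D I A) (R D I A) := fun a b c d =>
  all ((member hE hR (some a) (some b) none).iff
    (member hE hR (some c) (some d) none))

theorem separatesNames (hE : FODefinable₂ E) (hR : FODefinable₃ R) :
    FODefinable₅ fun D I A => SeparatesNames (E D I A) (R D I A) := fun v a b c d =>
  all (all ((member hE hR (some (some a)) (some (some b)) (some none)).imp
    ((member hE hR (some (some c)) (some (some d)) none).imp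
    ((eq (some none) (some (some v))).not.imp ((eq none (some (some v))).not.imp
    (hR (some (some v)) (some none) none).not)))))

theorem twiceSeparated (hE : FODefinable₂ E) (hR : FODefinable₃ R) {α : Type}
    (a b c d e f : α) : FODefinable fun D I A x =>
      TwiceSeparated (E D I A) (R D I A) (x a) (x b) (x c) (x d) (x e) (x f) :=
  ex (ex ((member hE hR (some (some c)) (some (some d)) (some none)).and
    ((member hE hR (some (some c)) (some (some d)) none).and
    ((eq (some none) none).not.and
    ((cutName hE hR (some none) (some none)).and
    ((cutName hE hR none none).and
    ((separatesNames hE hR (some none) (some (some a)) (some (some b)) (some (some e))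
      (some (some f))).and
    (separatesNames hE hR none (some (some a)) (some (some b)) (some (some e))
      (some (some f))))))))))

theorem betweenNames (hE : FODefinable₂ E) (hR : FODefinable₃ R) {α : Type}
    (a b c d e f : α) : FODefinable fun D I A x =>
      BetweenNames (E D I A) (R D I A) (x a) (x b) (x c) (x d) (x e) (x f) :=
  (nodeName hE hR a b).and ((nodeName hE hR e f).and ((conn hE hR a c).and ((conn hE hR a e).and
    (((cutName hE hR c d).and (separatesNames hE hR c a b e f)).or
    ((blockName hE hR c d).and ((sameMembers hE hR c d a b).or ((sameMembers hE hR c d e f).or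
    (twiceSeparated hE hR a b c d e f))))))))

theorem express (hE : FODefinable₂ E) (hR : FODefinable₃ R) (r : Rel) :
    FODefinable fun D I A x => r.express (E D I A) (R D I A) x := by
  cases r with
  | blockNode => exact blockName hE hR (α := Fin 2) 0 1
  | cutNode => exact cutName hE hR (α := Fin 2) 0 1
  | sameNode =>
    exact (nodeName hE hR (α := Fin 4) 0 1).and
      ((nodeName hE hR 2 3).and (sameMembers hE hR 0 1 2 3))
  | vertexOf => exact (nodeName hE hR (α := Fin 3) 0 1).and (member hE hR 0 1 2)
  | treeEdge =>
    exact ((cutName hE hR (α := Fin 4) 0 1).and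
      ((blockName hE hR 2 3).and (member hE hR 2 3 0))).or
      ((blockName hE hR 0 1).and ((cutName hE hR 2 3).and (member hE hR 0 1 2)))
  | between => exact betweenNames hE hR (α := Fin 6) 0 1 2 3 4 5

end Names

end FODefinable

end Rules

/-! ### The dynamic program -/

section BlockCutProgram

/-- The auxiliary relation symbols: the graph before the change, the order of its edges, the links
in the spanning forests, and the relations to be maintained. -/
inductive AuxRel : ℕ → Type
  | oldAdj : AuxRel 2
  | order : AuxRel 4
  | link : AuxRel 5
  | answer (r : Rel) : AuxRel r.arity

/-- The auxiliary schema. -/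
def auxSchema : FirstOrder.Language.{0, 0} := ⟨fun _ => Empty, AuxRel⟩

instance : auxSchema.IsRelational := fun _ => inferInstanceAs (IsEmpty Empty)

theorem finite_rel : Finite Rel :=
  Finite.of_injective (β := Fin 6)
    (fun r => match r with
      | .blockNode => 0
      | .cutNode => 1
      | .sameNode => 2
      | .vertexOf => 3
      | .treeEdge => 4
      | .between => 5)
    fun r s h => by cases r <;> cases s <;> first | rfl | simp at h

theorem finite_auxSchema : Finite (Σ n, auxSchema.Relations n) := by
  have := finite_rel
  refine Finite.of_surjective (α := Fin 3 ⊕ Rel)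
    (fun s => match s with
      | .inl 0 => ⟨2, .oldAdj⟩
      | .inl 1 => ⟨4, .order⟩
      | .inl 2 => ⟨5, .link⟩
      | .inr r => ⟨r.arity, .answer r⟩) ?_
  rintro ⟨n, R⟩
  cases R with
  | oldAdj => exact ⟨.inl 0, rfl⟩
  | order => exact ⟨.inl 1, rfl⟩
  | link => exact ⟨.inl 2, rfl⟩
  | answer r => exact ⟨.inr r, rfl⟩

variable {D : Type}

/-- The stored edge relation. -/
def oldAdj (A : Interp auxSchema D) (x y : D) : Prop := ![x, y] ∈ A 2 AuxRel.oldAdj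

/-- The stored order of the edges. -/
def order (A : Interp auxSchema D) (a b c d : D) : Prop := ![a, b, c, d] ∈ A 4 AuxRel.order

/-- The stored links in the spanning forests. -/
def link (A : Interp auxSchema D) (w u v x y : D) : Prop := ![w, u, v, x, y] ∈ A 5 AuxRel.link

/-- The links after the change. -/
def nextLink (I : Interp FirstOrder.Language.graph D) (A : Interp auxSchema D) :
    D → D → D → D → D → Prop :=
  newLink (oldAdj A) (toGraph I).Adj (order A) (link A)

/-- The update rules, as predicates. -/
def nextAux : (n : ℕ) → AuxRel n → Pred FirstOrder.Language.graph auxSchema (Fin n)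
  | _, .oldAdj => fun _ I _ x => (toGraph I).Adj (x 0) (x 1)
  | _, .order => fun _ I A x =>
      newOrder (oldAdj A) (toGraph I).Adj (order A) (x 0) (x 1) (x 2) (x 3)
  | _, .link => fun _ I A x => x 3 ≠ x 4 ∧ nextLink I A (x 0) (x 1) (x 2) (x 3) (x 4)
  | _, .answer r => fun _ I A x =>
      r.express (toGraph I).Adj (fun w => nextLink I A w w w) x

theorem foDefinable_toGraph :
    FODefinable₂ (σ := FirstOrder.Language.graph) (τ := auxSchema) fun _ I _ => (toGraph I).Adj :=
  fun i j => (FODefinable.eq i j).not.and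
    ((FODefinable.input₂ FirstOrder.Language.adj i j).or
      (FODefinable.input₂ FirstOrder.Language.adj j i))

theorem foDefinable_oldAdj : FODefinable₂ (σ := FirstOrder.Language.graph) fun _ _ A => oldAdj A :=
  FODefinable.aux₂ (τ := auxSchema) AuxRel.oldAdj

theorem foDefinable_order : FODefinable₄ (σ := FirstOrder.Language.graph) fun _ _ A => order A :=
  FODefinable.aux₄ (τ := auxSchema) AuxRel.order

theorem foDefinable_link : FODefinable₅ (σ := FirstOrder.Language.graph) fun _ _ A => link A :=
  FODefinable.aux₅ (τ := auxSchema) AuxRel.link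

theorem foDefinable_nextLink : FODefinable₅ fun _ I A => nextLink I A :=
  FODefinable.newLink foDefinable_oldAdj foDefinable_toGraph foDefinable_order foDefinable_link

theorem foDefinable_nextAux (n : ℕ) (T : AuxRel n) : FODefinable (nextAux n T) := by
  cases T with
  | oldAdj => exact foDefinable_toGraph (α := Fin 2) 0 1
  | order =>
    exact FODefinable.newOrder foDefinable_oldAdj foDefinable_toGraph foDefinable_order
      (α := Fin 4) 0 1 2 3
  | link =>
    exact (FODefinable.eq (3 : Fin 5) 4).not.and (foDefinable_nextLink 0 1 2 3 4)
  | answer r =>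
    exact FODefinable.express foDefinable_toGraph
      (fun w x y => foDefinable_nextLink w w w x y) r

/-- The dynamic program that maintains the BC-trees. -/
noncomputable def blockCutProgram : Program FirstOrder.Language.graph where
  aux := auxSchema
  relational := inferInstance
  finite := finite_auxSchema
  rule n T := (foDefinable_nextAux n T).choose

theorem mem_step_aux_iff (S : State blockCutProgram D) (Δ : Change FirstOrder.Language.graph D)
    {n : ℕ} (T : AuxRel n) (x : Fin n → D) :
    x ∈ (S.step Δ).aux n T ↔ nextAux n T D (Δ.apply S.input) S.aux x :=
  (foDefinable_nextAux n T).choose_spec D _ _ x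

/-- The auxiliary relations describe the input graph. -/
structure Invariant (S : State blockCutProgram D) : Prop where
  oldAdj : oldAdj S.aux = (toGraph S.input).Adj
  order : OrdersEdges (toGraph S.input) (order S.aux)
  link : DescribesForests (toGraph S.input) (link S.aux)

theorem toGraph_empty : toGraph (Interp.empty FirstOrder.Language.graph D) = ⊥ := by
  ext x y
  simp [toGraph, Interp.empty]

/-- The graph has no edges, so any order will do. Links are stored for distinct vertices only, which
makes the empty relation correct at the start. -/
theorem Invariant.init : Invariant (State.init blockCutProgram D) := by
  have hG : toGraph (State.init blockCutProgram D).input = ⊥ := toGraph_empty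
  refine ⟨?_, ?_, ?_⟩
  · rw [hG]
    rfl
  · rw [hG]
    exact ⟨fun _ => 0, by simp [Set.InjOn], fun _ _ _ _ h => h.elim⟩
  · rw [hG]
    refine fun w => ⟨⊥, ⟨bot_le, SimpleGraph.isAcyclic_bot, fun _ _ h => h.1.elim⟩, ?_⟩
    intro u v x y
    rw [SimpleGraph.deleteEdges_eq_self.2 (by simp), SimpleGraph.reachable_bot]
    exact or_iff_left id

theorem exists_differAt {Δ : Change FirstOrder.Language.graph D} (hΔ : Δ ∈ edgeUpdates D)
    (I : Interp FirstOrder.Language.graph D) :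
    ∃ a b, DifferAt (toGraph I) (toGraph (Δ.apply I)) a b := by
  obtain ⟨a, b, -, h⟩ := hΔ
  refine ⟨a, b, fun x y hxy => ?_⟩
  have h1 : ¬ edgeTuples a b x y := fun h => hxy (Sym2.eq_iff.2 h)
  have h2 : ¬ edgeTuples a b y x := fun h => hxy (Sym2.eq_iff.2 (h.symm.imp And.symm And.symm))
  rcases h with rfl | rfl <;>
    simp [toGraph, Change.apply, insertEdge, deleteEdge, edgeInterp, Interp.empty, h1, h2]

section Step

variable [Finite D] {S : State blockCutProgram D} {Δ : Change FirstOrder.Language.graph D}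

theorem Invariant.step (hS : Invariant S) (hΔ : Δ ∈ edgeUpdates D) : Invariant (S.step Δ) := by
  obtain ⟨a, b, h⟩ := exists_differAt hΔ S.input
  have hG : toGraph (S.step Δ).input = toGraph (Δ.apply S.input) := rfl
  refine ⟨?_, ?_, ?_⟩
  · ext x y
    exact mem_step_aux_iff S Δ .oldAdj ![x, y]
  · have : DynFO.order (S.step Δ).aux = newOrder (DynFO.oldAdj S.aux)
        (toGraph (Δ.apply S.input)).Adj (DynFO.order S.aux) := by
      ext a b c d
      exact mem_step_aux_iff S Δ .order ![a, b, c, d]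
    rw [hG, this, hS.oldAdj]
    exact hS.order.update h
  · intro w
    obtain ⟨F, hF, hFK⟩ := hS.link.update hS.order h w
    refine ⟨F, hF, fun u v x y => ?_⟩
    rw [← hFK, ← hS.oldAdj, reflLink]
    have : DynFO.link (S.step Δ).aux w u v x y ↔
        x ≠ y ∧ nextLink (Δ.apply S.input) S.aux w u v x y :=
      mem_step_aux_iff S Δ .link ![w, u, v, x, y]
    rw [this]
    -- The stored relation drops the pairs with `x = y`; there both sides are true, because
    -- reachability is reflexive.
    by_cases hxy : x = y
    · subst hxy
      refine iff_of_true (Or.inl rfl) ?_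
      rw [hS.oldAdj, hFK]
    · simp only [hxy, false_or, ne_eq, not_false_eq_true, true_and]
      exact Iff.rfl

/-- The rule for the answer recomputes the updated links from the old auxiliary relations, so the
invariant is only needed before the change. The old answers are never used. -/
theorem Invariant.answer (hS : Invariant S) (hΔ : Δ ∈ edgeUpdates D) (r : Rel) :
    (S.step Δ).aux r.arity (AuxRel.answer r) = r.query D (S.step Δ).input := by
  obtain ⟨a, b, h⟩ := exists_differAt hΔ S.input
  ext x
  refine (mem_step_aux_iff S Δ (.answer r) x).trans ?_
  have hR : (fun w => nextLink (Δ.apply S.input) S.aux w w w) =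
      reach (toGraph (Δ.apply S.input)) := by
    ext w x y
    change newLink (DynFO.oldAdj S.aux) (toGraph (Δ.apply S.input)).Adj (DynFO.order S.aux)
      (DynFO.link S.aux) w w w x y ↔ _
    rw [hS.oldAdj]
    exact newLink_diag_iff hS.order hS.link h w x y
  change r.express _ (fun w => nextLink (Δ.apply S.input) S.aux w w w) x ↔ _
  rw [hR]
  exact r.express_iff x

end Step

theorem Invariant.run [Finite D] (α : List (Change FirstOrder.Language.graph D))
    (h : ∀ Δ ∈ α, Δ ∈ edgeUpdates D) : Invariant (blockCutProgram.run α) := by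
  induction α using List.reverseRecOn with
  | nil => exact .init
  | append_singleton α Δ ih =>
    rw [Program.run, List.foldl_append]
    exact (ih fun Δ' h' => h Δ' (by simp [h'])).step (h Δ (by simp))

end BlockCutProgram

end DynFO

theorem mainTheorem7 :
    DynFO.Maintainable DynFO.edgeUpdates BCTree.Rel.query := by
  refine ⟨DynFO.blockCutProgram, DynFO.AuxRel.answer, fun D _ α hα h r => ?_⟩
  -- A last change is needed: the initially empty answers are wrong on a non-empty domain, where
  -- each isolated vertex is a block.
  obtain ⟨β, Δ, rfl⟩ := (List.eq_nil_or_concat' α).resolve_left hα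
  rw [DynFO.Program.run, List.foldl_append]
  exact (DynFO.Invariant.run β fun Δ' h' => h Δ' (by simp [h'])).answer (h Δ (by simp)) r
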